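/- **Setting.** Let $m\ge 2$, let $\mathcal C^k(m)=\{q=(x_0,\dots,x_k)\in(\mathbb R^{m+1})^{k+1}:\ |x_{i+1}-x_i|=1,\ 0\le i<k\}$ be the configuration space of an articulated arm $(M_0,\dots,M_k)$ with $k$ bars $[M_i,M_{i+1}]$, $x_i$ the position of $M_i$, and $q_n=(x_0,\dots,x_n)\in\mathcal C^n(m)$ the point under $q$. On $\mathcal C^k(m)$ let $\mathcal D_k=T\mathcal C^k(m)\cap\mathcal E_k$, a distribution of rank $m+1$, where $\mathcal E_k$ is generated by $\mathcal Z_i=\sum_r(x^r_{i+1}-x^r_i)\,\partial/\partial x^r_i$ $(0\le i<k)$ and $\partial/\partial x_k^r$ $(1\le r\le m+1)$. *Spherical prolongation.* For a submanifold $N$ with a distribution $\delta$, and a Riemannian metric on $\delta$, the spherical prolongation is the unit sphere bundle $\mathcal P^1(N)=\{(x,\nu):x\in N,\ \nu\in\delta(x),\ |\nu|=1\}$ with the distribution of the vectors tangent to $\mathcal P^1(N)$ at $(x,\nu)$ whose projection to $N$ lies in $\mathbb R\nu$; it is iterated to $\mathcal P^j(N)$. The space $\mathcal C^{n+1}(m)$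 is identified with the unit sphere bundle of $\mathcal D_n$ (for the metric $\langle w_n,w'_n\rangle$, where $w_n$ is the component of $w\in\mathcal D_n$ along $x_n$) by $(q,w)\mapsto(q,x_n+w_n)$; so $q_{n+1}=(q_n,z)$ with a unit vector $z\in\mathcal D_n(q_n)$. For $i\ge 1$ and $p\in\mathcal C^{i-1}(m)$ let $S^i(p)$ be the fiber of $\mathcal C^i(m)\to\mathcal C^{i-1}(m)$ over $p$, and let $\mathfrak d^i_j$ be the distribution of its $j$-th prolongation $\mathcal P^j(S^i(p))\subset\mathcal C^{i+j}(m)$, starting from $\mathfrak d^i_0=TS^i(p)$. *Codes.* The point $q_{n+1}=(q_n,z)$ is *critical* if for some $i\ge1$, $j\ge 0$ with $i+j=n$ one has $q_n\in\mathcal P^j(S^i(q_{i-1}))$ and $z\in\mathfrak d^i_j(q_n)$; it is *vertical* if this holds with $j=0$, *tangency* if it is critical and not vertical, *regular* if it is not critical. The RVT code of $q\in\mathcal C^k(m)$ is the word whose $n$-th letter is $R$, $V$ or $T$ if $q_n$ is regular, vertical or tangency. For $h\ge1$, $l\ge0$ let $\mathcal C_{R^hVT^l}\subset\mathcal C^{h+l+1}(m)$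 be the set of the points with code $R^hVT^l$. *Flags.* Let $D=D_k\subset D_{k-1}\subset\cdots\subset D_0$, $D_{j-1}=D_j+[D_j,D_j]$, be the flag of $D=\mathcal D_k$ on $\mathcal C^k(m)$, let $L(D_j)$ be the Cauchy characteristic distribution of $D_j$ for $j\ge 1$, and let "$L(D_0)$" stand for the unique completely integrable corank one subdistribution of $D_1$ (for $k\ge2$). A point of $\mathcal C^k(m)$ is a *Cartan point* if $D_{j-1}/L(D_{j-1})=L(D_{j-2})/L(D_{j-1})\oplus D_j/L(D_{j-1})$ there for all $2\le j\le k$; $\mathcal C^k(m)_C$ is the set of Cartan points. **Theorem.** 1. Let $q\in\mathcal C^k(m)$ be a tangency point. Then $q_i$ is vertical for some $2\le i\le k-1$, and if $l$ is the largest such $i$, then $q_j$ is tangency for every $l<j\le k$. Let now $h\ge 1$ and $l\ge 0$, and put $\varphi_j(q)=\langle x_{h+j+1}-x_{h+j},\,x_{h+j}-x_{h-1}\rangle$ for $0\le j\le l$. 2. $\mathcal C_{R^hVT^l}$ is an analytic submanifold of $\mathcal C^{h+l+1}(m)$ of codimension $l+1$. It is the set of the zeros of $\varphi_0,\dots,\varphi_l$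 in the open subset of $\mathcal C^{h+l+1}(m)$ of all $q$ such that $q_h$ has code $R^h$ and $q_{h+i+1}$ is not vertical for $1\le i\le l$; and $d\varphi_0,\dots,d\varphi_l$ are linearly independent on $T_q\mathcal C^{h+l+1}(m)$ at every common zero $q$. The map $q\mapsto q_h$ sends $\mathcal C_{R^hVT^l}$ onto $\mathcal C^h(m)_C$, and its fiber over $p=(x_0,\dots,x_h)\in\mathcal C^h(m)_C$ is the set of the points $q\in\mathcal P^{l+1}(S^h(p_{h-1}))$ over $p$, $p_{h-1}=(x_0,\dots,x_{h-1})$, such that $q_{h+i+1}$ is not vertical for $1\le i\le l$. 3. In $\mathcal C^{k}(m)$, $k=h+l+1$, with the flag of $\mathcal D_k$, write $\widetilde{\mathcal C}_\omega$ for the set of the $q$ such that $q_n$ has code $\omega$, $n$ being the length of $\omega$. Then (i) $\widetilde{\mathcal C}_{R^h}$ is the set of the $q$ such that $q_h$ is a Cartan point of $\mathcal C^h(m)$, and it is open; (ii) $\widetilde{\mathcal C}_{R^hV}$ is the set of the $q\in\widetilde{\mathcal C}_{R^h}$ with $D_{h+1}(q)\subset L(D_{h-1})(q)$; (iii) for $1\le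 i\le l$, $\widetilde{\mathcal C}_{R^hVT^i}$ is the set of the $q\in\widetilde{\mathcal C}_{R^hVT^{i-1}}$ such that $D_{h+i+1}(q)\subset T_q\widetilde{\mathcal C}_{R^hVT^{i-1}}$ and $q_{h+i+1}$ is not vertical. 4. On $\mathcal C_{R^hVT^l}$ one has $x_{h+i}\ne x_{h-1}$ for $0\le i\le l$. Let $K_i(q)=\mathbb R(x_{h+i}-x_{h-1})$. A configuration $q=(x_0,\dots,x_{h+l+1})\in\mathcal C^{h+l+1}(m)$ belongs to $\mathcal C_{R^hVT^l}$ if and only if * the bars $[M_{i-1},M_i]$ and $[M_i,M_{i+1}]$ are not orthogonal at $M_i$ for $1\le i\le h-1$, * the bar $[M_{h+i},M_{h+i+1}]$ is contained in the affine hyperplane through $x_{h+i}$ orthogonal to $K_i(q)$ for $0\le i\le l$, and * the bars $[M_{h+i-1},M_{h+i}]$ and $[M_{h+i},M_{h+i+1}]$ are not orthogonal at $M_{h+i}$ for $1\le i\le l$. -/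

import Mathlib

open scoped ContDiff Topology

namespace ArticulatedArm

noncomputable section

/-! ### Submanifolds, distributions and flags inside a normed space -/

section Ambient

variable {E : Type*} [NormedAddCommGroup E] [NormedSpace ℝ E]

/-- The tangent space at `q` of a subset `S` of `E` (used for embedded submanifolds):
the span of the velocities at time `0` of the curves in `S` passing through `q`. -/
def tangentSpace (S : Set E) (q : E) : Submodule ℝ E :=
  Submodule.span ℝ {v | ∃ γ : ℝ → E, γ 0 = q ∧ HasDerivAt γ v 0 ∧ ∀ᶠ t in 𝓝 (0 : ℝ), γ t ∈ S}

/-- `S` is an (embedded) analytic submanifold of codimension `r` of the submanifold `M` of `E`: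
near each of its points, `S` is the zero set in `M` of `r` analytic functions whose differentials
are independent on the tangent space of `M`. -/
def IsAnalyticSubmanifold (M S : Set E) (r : ℕ) : Prop :=
  S ⊆ M ∧ ∀ q ∈ S, ∃ (U : Set E) (f : E → Fin r → ℝ), IsOpen U ∧ q ∈ U ∧ AnalyticOnNhd ℝ f U ∧
    S ∩ U = {y | y ∈ M ∧ y ∈ U ∧ f y = 0} ∧
    Function.Surjective ((fderiv ℝ f q).toLinearMap.domRestrict (tangentSpace M q))

/-- `X`, defined on the open subset `U` of `E`, is smooth and restricts to a local vector field on
`M` tangent to the distribution `D`. (Each smooth local vector field on an embedded submanifold is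
locally such a restriction, and on `M` the bracket of fields tangent to `M` does not depend on the
extensions.) -/
structure IsLocalSection (M : Set E) (D : E → Submodule ℝ E) (U : Set E) (X : E → E) : Prop where
  isOpen : IsOpen U
  smooth : ContDiffOn ℝ ∞ X U
  tangent : ∀ y ∈ U ∩ M, X y ∈ D y

/-- The Lie square `D²` of a distribution `D` on `M`. -/
def lieSquare (M : Set E) (D : E → Submodule ℝ E) (q : E) : Submodule ℝ E :=
  Submodule.span ℝ
    ({v | ∃ U X, IsLocalSection M D U X ∧ q ∈ U ∧ X q = v} ∪
     {v | ∃ U X Y, IsLocalSection M D U X ∧ IsLocalSection M D U Y ∧ q ∈ U ∧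
        VectorField.lieBracket ℝ X Y q = v})

/-- The Cauchy characteristic distribution `L(D)`: it is generated by the local sections `X` of
`D` such that `[X, Y]` is tangent to `D` for every local section `Y` of `D`. -/
def cauchyCharacteristic (M : Set E) (D : E → Submodule ℝ E) (q : E) : Submodule ℝ E :=
  Submodule.span ℝ {v | ∃ U X, IsLocalSection M D U X ∧ q ∈ U ∧ X q = v ∧
    ∀ V Y, IsLocalSection M D V Y → ∀ y ∈ U ∩ V ∩ M, VectorField.lieBracket ℝ X Y y ∈ D y}

/-- `F` is a completely integrable (i.e. smooth, of constant rank and involutive) subdistribution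
of corank one of `D` on `M`. -/
structure IsIntegrableCorankOne (M : Set E) (D F : E → Submodule ℝ E) : Prop where
  le : ∀ q ∈ M, F q ≤ D q
  corank : ∀ q ∈ M, Module.finrank ℝ (F q) + 1 = Module.finrank ℝ (D q)
  smooth : ∀ q ∈ M, ∀ v ∈ F q, ∃ U X, IsLocalSection M F U X ∧ q ∈ U ∧ X q = v
  involutive : ∀ U X V Y, IsLocalSection M F U X → IsLocalSection M F V Y →
    ∀ y ∈ U ∩ V ∩ M, VectorField.lieBracket ℝ X Y y ∈ F y

/-- The completely integrable corank one subdistribution of `D`, for a distribution `D` that has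
exactly one (the sum of all of them makes sense in general). -/
def integrableCorankOne (M : Set E) (D : E → Submodule ℝ E) (q : E) : Submodule ℝ E :=
  ⨆ (F : E → Submodule ℝ E) (_ : IsIntegrableCorankOne M D F), F q

/-- The member `D_j` of the flag `D = D_k ⊂ D_{k-1} ⊂ ⋯ ⊂ D_0`, where `D_{j-1} = (D_j)²`. -/
def flag (M : Set E) (D : E → Submodule ℝ E) (k j : ℕ) : E → Submodule ℝ E :=
  (lieSquare M)^[k - j] D

/-- The lower line of the sandwich flag: `L(D_j)` for `j ≥ 1`, and, in the place of `L(D_0)`, the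
completely integrable subdistribution `F` of corank one of `D_1`. -/
def sandwichL (M : Set E) (D : E → Submodule ℝ E) (k j : ℕ) : E → Submodule ℝ E :=
  if j = 0 then integrableCorankOne M (flag M D k 1) else cauchyCharacteristic M (flag M D k j)

/-- Cartan points: in each sandwich number `j`, `2 ≤ j ≤ k`,
`D_{j-1}/L(D_{j-1}) = L(D_{j-2})/L(D_{j-1}) ⊕ D_j/L(D_{j-1})` at `q`. -/
def IsCartanPoint (M : Set E) (D : E → Submodule ℝ E) (k : ℕ) (q : E) : Prop :=
  ∀ j, 2 ≤ j → j ≤ k →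
    sandwichL M D k (j - 2) q ⊔ flag M D k j q = flag M D k (j - 1) q ∧
    sandwichL M D k (j - 2) q ⊓ flag M D k j q = sandwichL M D k (j - 1) q

end Ambient

/-! ### The configuration space of an articulated arm -/

/-- The space `(ℝ^{m+1})^{k+1}` of positions `(x_0, …, x_k)`. -/
abbrev Conf (m k : ℕ) : Type := Fin (k + 1) → EuclideanSpace ℝ (Fin (m + 1))

variable {m k : ℕ}

/-- The point `x_i` of `q = (x_0, …, x_k)`, for `i ≤ k`. -/
def joint (q : Conf m k) (i : ℕ) : EuclideanSpace ℝ (Fin (m + 1)) :=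
  if h : i ≤ k then q ⟨i, Nat.lt_succ_of_le h⟩ else 0

/-- The point `q_l = (x_0, …, x_l)` under `q`, for `l ≤ k`. -/
def under (l : ℕ) (q : Conf m k) : Conf m l := fun i => joint q i

/-- The configuration space `C^k(m)`: all the bars `[x_i, x_{i+1}]` have length one. -/
def configSpace (m k : ℕ) : Set (Conf m k) :=
  {q | ∀ i < k, ‖joint q (i + 1) - joint q i‖ = 1}

/-- The value at `q` of the vector field `Z_i = ∑ (x_{i+1}^r - x_i^r) ∂/∂x_i^r`, `i < k`. -/
def fieldZ (q : Conf m k) (i : Fin k) : Conf m k :=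
  Pi.single i.castSucc (q i.succ - q i.castSucc)

/-- The distribution `E_k` generated by `Z_0, …, Z_{k-1}, ∂/∂x_k^1, …, ∂/∂x_k^{m+1}`. -/
def kinematicDist (q : Conf m k) : Submodule ℝ (Conf m k) :=
  Submodule.span ℝ (Set.range (fieldZ q) ∪ Set.range (fun e => Pi.single (Fin.last k) e))

/-- The distribution `𝒟_k = T C^k(m) ∩ E_k` on `C^k(m)`. -/
def armDist (m k : ℕ) (q : Conf m k) : Submodule ℝ (Conf m k) :=
  tangentSpace (configSpace m k) q ⊓ kinematicDist q

/-! ### Spherical prolongation -/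

/-- A submanifold of `(ℝ^{m+1})^{k+1}` with a distribution on it. -/
structure DiffSystem (m k : ℕ) where
  carrier : Set (Conf m k)
  plane : Conf m k → Submodule ℝ (Conf m k)

/-- The system `(C^k(m), 𝒟_k)`. -/
def armSystem (m k : ℕ) : DiffSystem m k := ⟨configSpace m k, armDist m k⟩

/-- The bundle of the unit vectors `w` of the distribution, for the metric `⟨w_k, w'_k⟩`, `w_k`
being the component of `w` along `x_k`; this is a Riemannian metric on the bundle `𝒟_k`. -/
def sphereBundle (A : DiffSystem m k) : Set (Conf m k × Conf m k) :=
  {p | p.1 ∈ A.carrier ∧ p.2 ∈ A.plane p.1 ∧ ‖p.2 (Fin.last k)‖ = 1}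

/-- The spherical prolongation of the distribution: at `(q, w)`, the tangent vectors of the sphere
bundle that project into the line `ℝ w`. -/
def sphericalDist (A : DiffSystem m k) (p : Conf m k × Conf m k) :
    Submodule ℝ (Conf m k × Conf m k) :=
  tangentSpace (sphereBundle A) p ⊓
    (Submodule.span ℝ {p.2}).comap (LinearMap.fst ℝ (Conf m k) (Conf m k))

/-- The map `((x_0, …, x_k), w) ↦ (x_0, …, x_k, x_k + w_k)`. It restricts to the diffeomorphism
from the unit sphere bundle of `𝒟_k` onto `C^{k+1}(m)` that carries the spherical prolongation of
`𝒟_k` to `𝒟_{k+1}`, and thus identifies the tower of the `C^k(m)` with the tower of spherical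
prolongations of `T ℝ^{m+1}`. -/
def addBar : (Conf m k × Conf m k) →ₗ[ℝ] Conf m (k + 1) where
  toFun p := Fin.snoc (α := fun _ => EuclideanSpace ℝ (Fin (m + 1))) p.1
    (p.1 (Fin.last k) + p.2 (Fin.last k))
  map_add' p p' := by
    funext i
    refine Fin.lastCases ?_ (fun i => ?_) i
    · simp only [Fin.snoc_last, Pi.add_apply, Prod.fst_add, Prod.snd_add]; abel
    · simp only [Fin.snoc_castSucc, Pi.add_apply, Prod.fst_add]
  map_smul' c p := by
    funext i
    refine Fin.lastCases ?_ (fun i => ?_) i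
    · simp
    · simp

/-- The spherical prolongation of a system contained in `(C^k(m), 𝒟_k)`, as a system contained in
`(C^{k+1}(m), 𝒟_{k+1})` by means of `addBar` (`addBar` is injective on the sphere bundle). -/
def prolong (A : DiffSystem m k) : DiffSystem m (k + 1) where
  carrier := addBar '' sphereBundle A
  plane q := ⨆ p ∈ {p | p ∈ sphereBundle A ∧ addBar p = q}, (sphericalDist A p).map addBar

/-- The fiber `S^i(p)` of `C^i(m) → C^{i-1}(m)` over `p`, for `i ≥ 1`, with its tangent bundle. -/
def fiberSystem (i : ℕ) (p : Conf m (i - 1)) : DiffSystem m i where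
  carrier := {q | q ∈ configSpace m i ∧ under (i - 1) q = p}
  plane := tangentSpace {q | q ∈ configSpace m i ∧ under (i - 1) q = p}

/-- The fiber prolongation tower: the `j`-th spherical prolongation of the fiber `S^i(p)`, that is
the subset `P^j(S^i(p))` of `C^{i+j}(m)` with its distribution `𝔡^i_j`. -/
def fiberTower (i : ℕ) (p : Conf m (i - 1)) : (j : ℕ) → DiffSystem m (i + j)
  | 0 => fiberSystem i p
  | j + 1 => prolong (fiberTower i p j)

/-! ### Regular, vertical and tangency points; RVT codes -/

/-- Let `n = i + j < k` and write `q_{n+1} = (q_n, z)` with a unit vector `z` of `𝒟_n(q_n)`. The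
point `q_n` lies in the prolongation `P^j(S^i(q_{i-1}))` of the fiber, and `z` lies in the critical
hyperplane `𝔡^i_j(q_n)` of `𝒟_n(q_n)`. -/
def LiesInCritical (q : Conf m k) (i j : ℕ) : Prop :=
  under (i + j) q ∈ (fiberTower i (under (i - 1) q) j).carrier ∧
  ∃ w, (under (i + j) q, w) ∈ sphereBundle (armSystem m (i + j)) ∧
    addBar (under (i + j) q, w) = under (i + j + 1) q ∧
    w ∈ (fiberTower i (under (i - 1) q) j).plane (under (i + j) q)

/-- The point `q_n` under `q` is critical: its direction lies in some critical hyperplane. -/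
def IsCritical (q : Conf m k) (n : ℕ) : Prop :=
  ∃ i j, 1 ≤ i ∧ i + j + 1 = n ∧ LiesInCritical q i j

/-- The point `q_n` under `q` is vertical: its direction is tangent to the fiber of
`C^{n-1}(m) → C^{n-2}(m)`. -/
def IsVertical (q : Conf m k) (n : ℕ) : Prop :=
  ∃ i, 1 ≤ i ∧ i + 1 = n ∧ LiesInCritical q i 0

/-- The point `q_n` under `q` is tangency: critical, but not vertical. -/
def IsTangency (q : Conf m k) (n : ℕ) : Prop := IsCritical q n ∧ ¬ IsVertical q n

/-- Letters of the RVT code. -/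
inductive Letter
  | R
  | V
  | T

open Classical in
/-- The letter of rank `n` in the RVT code of `q`. -/
def letter (q : Conf m k) (n : ℕ) : Letter :=
  if IsVertical q n then Letter.V else if IsTangency q n then Letter.T else Letter.R

/-- The RVT code of `q`, a word of length `k`. -/
def rvtCode (q : Conf m k) : List Letter := (List.range k).map fun n => letter q (n + 1)

/-- The word `R^h`. -/
def wordR (h : ℕ) : List Letter := List.replicate h Letter.R

/-- The word `R^h V T^l`. -/
def wordRVT (h l : ℕ) : List Letter := wordR h ++ Letter.V :: List.replicate l Letter.T

/-- For a word of length `n ≤ k`: the set of the points `q` of `C^k(m)` such that the code of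
`q_n` is this word. For `k = n` this is the class of the word. -/
def rvtClass (m k n : ℕ) (word : List Letter) : Set (Conf m k) :=
  {q | q ∈ configSpace m k ∧ rvtCode (under n q) = word}

/-- The set of Cartan points of `C^k(m)`. -/
def cartanSet (m k : ℕ) : Set (Conf m k) :=
  {q | q ∈ configSpace m k ∧ IsCartanPoint (configSpace m k) (armDist m k) k q}

/-- The function `φ_j(q) = ⟨x_{h+j+1} - x_{h+j}, x_{h+j} - x_{h-1}⟩`, for `h ≥ 1`. -/
def tangencyEq (h j : ℕ) (q : Conf m k) : ℝ :=
  inner ℝ (joint q (h + j + 1) - joint q (h + j)) (joint q (h + j) - joint q (h - 1))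

/-- The direction `K_i(q)` generated by `x_{h+i} - x_{h-1}`, for `h ≥ 1`. -/
def directionK (h i : ℕ) (q : Conf m k) : Submodule ℝ (EuclideanSpace ℝ (Fin (m + 1))) :=
  Submodule.span ℝ {joint q (h + i) - joint q (h - 1)}

/-- The bars `[M_{i-1}, M_i]` and `[M_i, M_{i+1}]` are orthogonal at `M_i`, for `1 ≤ i < k`. -/
def BarsOrthogonal (q : Conf m k) (i : ℕ) : Prop :=
  inner ℝ (joint q i - joint q (i - 1)) (joint q (i + 1) - joint q i) = 0

end

end ArticulatedArm

open ArticulatedArm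

namespace ArticulatedArm

open Filter

/-! ### Coordinates -/

section Coordinates

variable {m k : ℕ}

/-! Write u_i = x_{i+1} - x_i. In coordinates the whole theorem becomes linear algebra. A tangent
vector w of the configuration space satisfies ⟨w_{i+1} - w_i, u_i⟩ = 0; if moreover w_i is parallel
to u_i, this forces the chain relation w_i = ⟨w_{i+1}, u_i⟩ u_i. So the arm distribution is given by
all the chain relations, and a bracket computation modulo u_i (`joint_lieBracket`) shows that each
Lie square drops the topmost one: D_j keeps those with i < j (`flag_eq`). In the lower line, L(D_j)
is the space of motions freezing x_0, …, x_j, and the integrable corank one subdistribution of D_1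
is the space of motions freezing x_0 (`sandwichL_eq`). Reading the sandwich on the component
w_{i+1}, the Cartan condition says that the line ℝu_{i+1} and the hyperplane orthogonal to u_i are
complementary, that is, consecutive bars are not orthogonal (`isCartanPoint_iff`).

For the fibers, put φ^i_s = ⟨u_{i+s}, x_{i+s} - x_{i-1}⟩. By induction on j (`fiberTower_eq`),
P^j(S^i(p)) is the set over p where φ^i_s = 0 for s < j, and its plane consists of the chain vectors
with w_{i+j} orthogonal to x_{i+j} - x_{i-1}. The induction rests on `tangencyDeriv_of_chain`: where
φ^i_s = 0, and along chain vectors fixing x_{i-1}, dφ^i_s(w) = ⟨w_{i+s+1}, x_{i+s+1} - x_{i-1}⟩,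
which is φ^i_{s+1} when w_{i+s+1} is the next bar. Hence criticality for (i, j) means φ^i_0 = ⋯ =
φ^i_j = 0 (`liesInCritical_iff`). The equation φ^i_0 = 0 is verticality of q_{i+1}, so each critical
point lies over, or is, a vertical one, and in the code R^hVT^l only the tower starting at i = h can
occur (`mem_rvtClass_wordRVT`).

Finally, φ_0 = ⋯ = φ_{j-1} = 0 makes successive increments orthogonal, so |x_{h+j} - x_{h-1}|² = j +
1 by Pythagoras. These vectors therefore never vanish, which gives the independence of the dφ_j, the
nonempty fibers over Cartan points, and curves with any velocity allowed by the linearized equations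
(`exists_curve`), hence all the tangent spaces. -/

/-- The position `x_i` as a continuous linear map. -/
noncomputable def jointL (m k i : ℕ) : Conf m k →L[ℝ] EuclideanSpace ℝ (Fin (m + 1)) :=
  if h : i ≤ k then ContinuousLinearMap.proj (⟨i, Nat.lt_succ_of_le h⟩ : Fin (k + 1)) else 0

lemma jointL_apply (i : ℕ) (q : Conf m k) : jointL m k i q = joint q i := by
  unfold jointL joint
  split <;> simp

/-- The bar vector `x_{i+1} - x_i`. -/
noncomputable def bar (q : Conf m k) (i : ℕ) : EuclideanSpace ℝ (Fin (m + 1)) :=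
  joint q (i + 1) - joint q i

/-- The vector `x_{h+j} - x_{h-1}`. -/
noncomputable def reach (h j : ℕ) (q : Conf m k) : EuclideanSpace ℝ (Fin (m + 1)) :=
  joint q (h + j) - joint q (h - 1)

lemma bar_eq (q : Conf m k) (i : ℕ) : bar q i = joint q (i + 1) - joint q i := rfl

lemma tangencyEq_eq (h j : ℕ) (q : Conf m k) :
    tangencyEq h j q = inner ℝ (bar q (h + j)) (reach h j q) := rfl

/-- The bar vector as a continuous linear map. -/
noncomputable def barL (m k i : ℕ) : Conf m k →L[ℝ] EuclideanSpace ℝ (Fin (m + 1)) :=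
  jointL m k (i + 1) - jointL m k i

lemma barL_apply (i : ℕ) (q : Conf m k) : barL m k i q = bar q i := by
  simp [barL, bar, jointL_apply]

/-- The vector `x_{h+j} - x_{h-1}` as a continuous linear map. -/
noncomputable def reachL (m k h j : ℕ) : Conf m k →L[ℝ] EuclideanSpace ℝ (Fin (m + 1)) :=
  jointL m k (h + j) - jointL m k (h - 1)

lemma reachL_apply (h j : ℕ) (q : Conf m k) : reachL m k h j q = reach h j q := by
  simp [reachL, reach, jointL_apply]

lemma joint_add (q p : Conf m k) (i : ℕ) : joint (q + p) i = joint q i + joint p i := by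
  simp [← jointL_apply]

lemma joint_sub (q p : Conf m k) (i : ℕ) : joint (q - p) i = joint q i - joint p i := by
  simp [← jointL_apply]

lemma joint_smul (c : ℝ) (q : Conf m k) (i : ℕ) : joint (c • q) i = c • joint q i := by
  simp [← jointL_apply]

lemma joint_zero (i : ℕ) : joint (0 : Conf m k) i = 0 := by
  simp [← jointL_apply]

lemma bar_add (q p : Conf m k) (i : ℕ) : bar (q + p) i = bar q i + bar p i := by
  simp [← barL_apply]

lemma bar_sub (q p : Conf m k) (i : ℕ) : bar (q - p) i = bar q i - bar p i := by
  simp [← barL_apply]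

lemma bar_smul (c : ℝ) (q : Conf m k) (i : ℕ) : bar (c • q) i = c • bar q i := by
  simp [← barL_apply]

lemma bar_zero (i : ℕ) : bar (0 : Conf m k) i = 0 := by
  simp [← barL_apply]

lemma contDiff_joint {n : WithTop ℕ∞} (i : ℕ) :
    ContDiff ℝ n (fun q : Conf m k => joint q i) :=
  (funext fun q => jointL_apply i q : ⇑(jointL m k i) = fun q => joint q i) ▸ (jointL m k i).contDiff

lemma contDiff_bar {n : WithTop ℕ∞} (i : ℕ) : ContDiff ℝ n (fun q : Conf m k => bar q i) :=
  (funext fun q => barL_apply i q : ⇑(barL m k i) = fun q => bar q i) ▸ (barL m k i).contDiff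

lemma contDiff_reach {n : WithTop ℕ∞} (h j : ℕ) :
    ContDiff ℝ n (fun q : Conf m k => reach h j q) :=
  (funext fun q => reachL_apply h j q : ⇑(reachL m k h j) = fun q => reach h j q) ▸
    (reachL m k h j).contDiff

lemma continuous_bar (i : ℕ) : Continuous (fun q : Conf m k => bar q i) :=
  (contDiff_bar (n := 0) i).continuous

lemma hasFDerivAt_bar (i : ℕ) (q : Conf m k) :
    HasFDerivAt (fun q : Conf m k => bar q i) (barL m k i) q :=
  (barL m k i).hasFDerivAt.congr_of_eventuallyEq
    (Eventually.of_forall fun y => (barL_apply i y).symm)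

lemma hasFDerivAt_reach (h j : ℕ) (q : Conf m k) :
    HasFDerivAt (fun q : Conf m k => reach h j q) (reachL m k h j) q :=
  (reachL m k h j).hasFDerivAt.congr_of_eventuallyEq
    (Eventually.of_forall fun y => (reachL_apply h j y).symm)

lemma hasFDerivAt_joint (i : ℕ) (q : Conf m k) :
    HasFDerivAt (fun q : Conf m k => joint q i) (jointL m k i) q :=
  (jointL m k i).hasFDerivAt.congr_of_eventuallyEq
    (Eventually.of_forall fun y => (jointL_apply i y).symm)

/-- The configuration with the given positions. -/
def ofSeq (m k : ℕ) (x : ℕ → EuclideanSpace ℝ (Fin (m + 1))) : Conf m k := fun i => x i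

lemma joint_ofSeq (x : ℕ → EuclideanSpace ℝ (Fin (m + 1))) {i : ℕ} (h : i ≤ k) :
    joint (ofSeq m k x) i = x i := by
  simp [joint, ofSeq, h]

lemma joint_of_le (q : Conf m k) {i : ℕ} (h : i ≤ k) :
    joint q i = q ⟨i, Nat.lt_succ_of_le h⟩ := by
  simp [joint, h]

lemma joint_val (q : Conf m k) (i : Fin (k + 1)) : joint q i = q i :=
  joint_of_le q (Nat.le_of_lt_succ i.2)

lemma joint_last (q : Conf m k) : joint q k = q (Fin.last k) := joint_val q (Fin.last k)

lemma conf_ext {q p : Conf m k} (h : ∀ i ≤ k, joint q i = joint p i) : q = p := by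
  funext i
  rw [← joint_val q, ← joint_val p]
  exact h i (Nat.le_of_lt_succ i.2)

lemma joint_under {l i : ℕ} (h : i ≤ l) (q : Conf m k) : joint (under l q) i = joint q i := by
  simp [joint_of_le _ h, under]

lemma bar_under {l i : ℕ} (h : i < l) (q : Conf m k) : bar (under l q) i = bar q i := by
  simp [bar, joint_under h, joint_under h.le]

lemma tangencyEq_under {l h j : ℕ} (hl : h + j < l) (q : Conf m k) :
    tangencyEq h j (under l q) = tangencyEq h j q := by
  simp only [tangencyEq]
  rw [joint_under (by omega), joint_under (by omega), joint_under (by omega)]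

lemma under_under {l n : ℕ} (h : n ≤ l) (q : Conf m k) : under n (under l q) = under n q :=
  conf_ext fun i hi => by rw [joint_under hi, joint_under (hi.trans h), joint_under hi]

lemma under_mem {l : ℕ} (h : l ≤ k) {q : Conf m k} (hq : q ∈ configSpace m k) :
    under l q ∈ configSpace m l := fun i hi => by
  rw [joint_under hi, joint_under hi.le]
  exact hq i (hi.trans_le h)

lemma norm_bar {q : Conf m k} (hq : q ∈ configSpace m k) {i : ℕ} (hi : i < k) :
    ‖bar q i‖ = 1 := hq i hi

lemma inner_bar_self {q : Conf m k} (hq : q ∈ configSpace m k) {i : ℕ} (hi : i < k) :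
    inner ℝ (bar q i) (bar q i) = (1 : ℝ) := by
  rw [real_inner_self_eq_norm_sq, norm_bar hq hi, one_pow]

lemma bar_ne_zero {q : Conf m k} (hq : q ∈ configSpace m k) {i : ℕ} (hi : i < k) :
    bar q i ≠ 0 := by
  rw [← norm_ne_zero_iff, norm_bar hq hi]; exact one_ne_zero

lemma joint_succ (q : Conf m k) (i : ℕ) : joint q (i + 1) = joint q i + bar q i := by
  simp [bar]

lemma reach_succ (h j : ℕ) (q : Conf m k) : reach h (j + 1) q = reach h j q + bar q (h + j) := by
  simp only [reach, bar, ← add_assoc]; abel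

lemma reach_zero {h : ℕ} (hh : 1 ≤ h) (q : Conf m k) : reach h 0 q = bar q (h - 1) := by
  simp only [reach, bar, add_zero, Nat.sub_add_cancel hh]

/-- Under the equations `φ_0 = ⋯ = φ_{j-1} = 0`, one has `|x_{h+j} - x_{h-1}|² = j + 1`. -/
lemma inner_reach_self {h J : ℕ} (hh : 1 ≤ h) (hJ : h + J ≤ k) {q : Conf m k}
    (hq : q ∈ configSpace m k) (hφ : ∀ j < J, tangencyEq h j q = 0) :
    ∀ j ≤ J, inner ℝ (reach h j q) (reach h j q) = ((j : ℝ) + 1) := by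
  intro j
  induction j with
  | zero =>
    intro _
    rw [reach_zero hh, inner_bar_self hq (by omega)]; simp
  | succ j ih =>
    intro hj
    have h1 := hφ j hj
    rw [tangencyEq_eq] at h1
    rw [reach_succ, inner_add_add_self, ih (by omega), inner_bar_self hq (by omega), h1,
      real_inner_comm, h1]
    push_cast; ring

lemma reach_ne_zero {h J : ℕ} (hh : 1 ≤ h) (hJ : h + J ≤ k) {q : Conf m k}
    (hq : q ∈ configSpace m k) (hφ : ∀ j < J, tangencyEq h j q = 0) {j : ℕ} (hj : j ≤ J) :
    reach h j q ≠ 0 := by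
  intro h0
  have := inner_reach_self hh hJ hq hφ j hj
  rw [h0, inner_zero_left] at this
  linarith [(Nat.cast_nonneg j : (0 : ℝ) ≤ j)]

/-- The differential of `φ_j`. -/
noncomputable def tangencyDeriv (h j : ℕ) (q : Conf m k) : Conf m k →L[ℝ] ℝ :=
  (fderivInnerCLM ℝ (bar q (h + j), reach h j q)).comp
    ((barL m k (h + j)).prod (reachL m k h j))

lemma tangencyDeriv_apply (h j : ℕ) (q w : Conf m k) : tangencyDeriv h j q w =
    inner ℝ (bar q (h + j)) (reach h j w) + inner ℝ (bar w (h + j)) (reach h j q) := by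
  simp [tangencyDeriv, barL_apply, reachL_apply]

lemma hasFDerivAt_tangencyEq (h j : ℕ) (q : Conf m k) :
    HasFDerivAt (fun y : Conf m k => tangencyEq h j y) (tangencyDeriv h j q) q :=
  (hasFDerivAt_bar (h + j) q).inner ℝ (hasFDerivAt_reach h j q)

end Coordinates

/-! ### Curves -/

section Curves

/-- Since v is orthogonal to the unit vector u, the norm of g has derivative zero at 0, so
normalizing does not change the velocity. -/
lemma hasDerivAt_normalize {V : Type*} [NormedAddCommGroup V] [InnerProductSpace ℝ V]
    {g : ℝ → V} {u v : V} (h0 : g 0 = u) (hg : HasDerivAt g v 0) (hu : ‖u‖ = 1)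
    (huv : inner ℝ v u = (0 : ℝ)) :
    HasDerivAt (fun t => ‖g t‖⁻¹ • g t) v 0 := by
  have hne : g 0 ≠ 0 := by rw [h0, ← norm_ne_zero_iff, hu]; exact one_ne_zero
  have h2 : HasDerivAt (fun t => ‖g t‖) 0 0 := by
    have h3 := (hg.norm_sq).sqrt (by simpa using hne)
    rw [h0, real_inner_comm, huv] at h3
    simpa [Real.sqrt_sq (norm_nonneg _)] using h3
  have h4 := (h2.inv (by simpa using hne)).smul hg
  exact HasDerivAt.congr_deriv h4 (by simp [h0, hu])

/-- A curve of unit vectors orthogonal to a given curve `b` with given initial velocity. -/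
lemma exists_unit_curve {V : Type*} [NormedAddCommGroup V] [InnerProductSpace ℝ V]
    {u v b' : V} {b : ℝ → V} (hu : ‖u‖ = 1) (huv : inner ℝ v u = (0 : ℝ))
    (hb : HasDerivAt b b' 0) (hb0 : b 0 ≠ 0 ∨ b = 0) (hub : inner ℝ u (b 0) = (0 : ℝ))
    (hvb : inner ℝ v (b 0) + inner ℝ u b' = (0 : ℝ)) :
    ∃ c : ℝ → V, c 0 = u ∧ HasDerivAt c v 0 ∧
      ∀ᶠ t in 𝓝 (0 : ℝ), ‖c t‖ = 1 ∧ inner ℝ (c t) (b t) = (0 : ℝ) := by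
  -- The straight line u + tv is projected orthogonally to b t, giving g, and then normalized. The
  -- hypothesis `hvb` makes the correction s vanish to first order, so the velocity stays v. If b =
  -- 0 there is nothing to correct; this case encodes the absence of an orthogonality constraint.
  set s : ℝ → ℝ := fun t => inner ℝ (u + t • v) (b t) with hs
  set g : ℝ → V := fun t => (u + t • v) - (s t / inner ℝ (b t) (b t)) • b t with hg
  have hl : HasDerivAt (fun t : ℝ => u + t • v) v 0 := by
    simpa using ((hasDerivAt_id (0 : ℝ)).smul_const v).const_add u
  have hs0 : s 0 = 0 := by simp [hs, hub]
  have hsd : HasDerivAt s 0 0 := by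
    have := hl.inner ℝ hb
    simp only [zero_smul, add_zero] at this
    rwa [add_comm, hvb] at this
  have hg0 : g 0 = u := by simp [hg, hs0]
  have hgd : HasDerivAt g v 0 := by
    rcases hb0 with hb0 | hb0
    · have hbb : inner ℝ (b 0) (b 0) ≠ (0 : ℝ) := by simpa using hb0
      have := hl.sub ((hsd.div (hb.inner ℝ hb) hbb).smul hb)
      exact HasDerivAt.congr_deriv this (by simp [hs0])
    · have : g = fun t => u + t • v := by funext t; simp [hg, hb0]
      rw [this]; exact hl
  have hne : g 0 ≠ 0 := by rw [hg0, ← norm_ne_zero_iff, hu]; exact one_ne_zero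
  refine ⟨fun t => ‖g t‖⁻¹ • g t, by simp [hg0, hu], hasDerivAt_normalize hg0 hgd hu huv, ?_⟩
  filter_upwards [hgd.continuousAt.eventually_ne hne] with t ht
  refine ⟨by rw [norm_smul, norm_inv, norm_norm, inv_mul_cancel₀ (norm_ne_zero_iff.2 ht)], ?_⟩
  rw [inner_smul_left]
  have : inner ℝ (g t) (b t) = (0 : ℝ) := by
    simp only [hg, inner_sub_left, inner_smul_left, RCLike.conj_to_real]
    by_cases hbt : b t = 0
    · simp [hbt]
    · rw [div_mul_cancel₀ _ (by simpa using hbt)]; simp [hs]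
  rw [this, mul_zero]

/-- The joints are moved one after another: joint N + 1 follows joint N plus a unit curve from
`exists_unit_curve`, kept orthogonal to the vector from joint r to joint N when C N holds. The
condition r ≤ s in `hC` ensures that adding a later joint does not disturb the constraints already
met. -/
lemma exists_curve_seq {V : Type*} [NormedAddCommGroup V] [InnerProductSpace ℝ V]
    (x w : ℕ → V) (r n₀ : ℕ) (C : ℕ → Prop) (N : ℕ)
    (hbar : ∀ s, n₀ ≤ s → s < N → ‖x (s + 1) - x s‖ = 1 ∧
      inner ℝ (w (s + 1) - w s) (x (s + 1) - x s) = (0 : ℝ))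
    (hC : ∀ s, n₀ ≤ s → s < N → C s → r ≤ s ∧ x s - x r ≠ 0 ∧
      inner ℝ (x (s + 1) - x s) (x s - x r) = (0 : ℝ) ∧
      inner ℝ (w (s + 1) - w s) (x s - x r) + inner ℝ (x (s + 1) - x s) (w s - w r) = (0 : ℝ)) :
    ∃ γ : ℕ → ℝ → V, (∀ s, γ s 0 = x s ∧ HasDerivAt (γ s) (w s) 0) ∧
      (∀ s ≤ n₀, γ s = fun t => x s + t • w s) ∧
      ∀ s, n₀ ≤ s → s < N → ∀ᶠ t in 𝓝 (0 : ℝ), ‖γ (s + 1) t - γ s t‖ = 1 ∧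
        (C s → inner ℝ (γ (s + 1) t - γ s t) (γ s t - γ r t) = (0 : ℝ)) := by
  classical
  induction N with
  | zero =>
    refine ⟨fun s t => x s + t • w s, fun s => ⟨by simp, ?_⟩, fun _ _ => rfl, fun s _ h => by omega⟩
    simpa using ((hasDerivAt_id (0 : ℝ)).smul_const (w s)).const_add (x s)
  | succ N ih =>
    obtain ⟨γ, h1, h2, h3⟩ := ih (fun s a b => hbar s a (by omega)) (fun s a b => hC s a (by omega))
    by_cases hn : n₀ ≤ N
    swap
    · exact ⟨γ, h1, h2, fun s a b => by omega⟩
    obtain ⟨hu, huv⟩ := hbar N hn (by omega)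
    obtain ⟨c, hc0, hcd, hc⟩ : ∃ c : ℝ → V, c 0 = x (N + 1) - x N ∧
        HasDerivAt c (w (N + 1) - w N) 0 ∧ ∀ᶠ t in 𝓝 (0 : ℝ), ‖c t‖ = 1 ∧
          (C N → inner ℝ (c t) (γ N t - γ r t) = (0 : ℝ)) := by
      by_cases hCN : C N
      · obtain ⟨-, k2, k3, k4⟩ := hC N hn (by omega) hCN
        obtain ⟨c, e1, e2, e3⟩ := exists_unit_curve (b := fun t => γ N t - γ r t) hu huv
          ((h1 N).2.sub (h1 r).2) (Or.inl (by simpa [(h1 _).1] using k2))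
          (by simpa [(h1 _).1] using k3) (by simpa [(h1 _).1] using k4)
        exact ⟨c, e1, e2, e3.mono fun t ht => ⟨ht.1, fun _ => ht.2⟩⟩
      · obtain ⟨c, e1, e2, e3⟩ := exists_unit_curve (b := 0) (b' := 0) hu huv
          (hasDerivAt_const _ _) (Or.inr rfl) (by simp) (by simp)
        exact ⟨c, e1, e2, e3.mono fun t ht => ⟨ht.1, fun h => absurd h hCN⟩⟩
    refine ⟨Function.update γ (N + 1) (fun t => γ N t + c t), fun s => ?_, fun s hs => ?_,
      fun s hs hsN => ?_⟩
    · by_cases hs : s = N + 1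
      · subst hs
        simp only [Function.update_self]
        refine ⟨by simp [(h1 N).1, hc0], ?_⟩
        have := (h1 N).2.add hcd
        rwa [add_sub_cancel] at this
      · rw [Function.update_of_ne hs]; exact h1 s
    · rw [Function.update_of_ne (by omega)]; exact h2 s hs
    · rw [Function.update_of_ne (show s ≠ N + 1 by omega)]
      by_cases hsN' : s = N
      · subst hsN'
        rw [Function.update_self]
        by_cases hCs : C s
        · rw [Function.update_of_ne (by have := (hC s hn (by omega) hCs).1; omega)]
          simpa using hc
        · simpa [hCs] using hc
      · rw [Function.update_of_ne (show s + 1 ≠ N + 1 by omega)]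
        by_cases hCs : C s
        · rw [Function.update_of_ne (by have := (hC s hs (by omega) hCs).1; omega)]
          exact h3 s hs (by omega)
        · simpa [hCs] using h3 s hs (by omega)

variable {m k : ℕ}

/-- The linearized bar equations at `q`. -/
noncomputable def tangentModel (q : Conf m k) : Submodule ℝ (Conf m k) where
  carrier := {w | ∀ i < k, inner ℝ (bar w i) (bar q i) = (0 : ℝ)}
  add_mem' ha hb i hi := by rw [bar_add, inner_add_left, ha i hi, hb i hi, add_zero]
  zero_mem' i _ := by rw [bar_zero, inner_zero_left]
  smul_mem' c a ha i hi := by rw [bar_smul, inner_smul_left, ha i hi, mul_zero]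

/-- Each solution of the linearized equations is the velocity of an actual curve of solutions; this
plays the role of the implicit function theorem. The nonvanishing needed for orthogonality to
x_{h+j} - x_{h-1} comes from `reach_ne_zero`. The joints up to n₀ move on straight lines, so they
stay fixed when their velocity is zero. -/
lemma exists_curve {q w : Conf m k} (hq : q ∈ configSpace m k) (hw : w ∈ tangentModel q)
    {h J : ℕ} (hh : 1 ≤ h) (hJ : h + J ≤ k) (hφ : ∀ j < J, tangencyEq h j q = 0)
    (hdφ : ∀ j < J, tangencyDeriv h j q w = 0) {n₀ : ℕ} (hn₀ : n₀ ≤ h)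
    (hrigid : ∀ s < n₀, bar w s = 0) :
    ∃ γ : ℝ → Conf m k, γ 0 = q ∧ HasDerivAt γ w 0 ∧
      (∀ s ≤ n₀, ∀ t, joint (γ t) s = joint q s + t • joint w s) ∧
      ∀ᶠ t in 𝓝 (0 : ℝ), γ t ∈ configSpace m k ∧ ∀ j < J, tangencyEq h j (γ t) = 0 := by
  obtain ⟨γ, h1, h2, h3⟩ := exists_curve_seq (joint q) (joint w) (h - 1) n₀
    (fun s => h ≤ s ∧ s < h + J) k (fun s _ hs => ⟨norm_bar hq hs, hw s hs⟩) (by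
      rintro s - hs ⟨ha, hb⟩
      obtain ⟨j, rfl⟩ := Nat.exists_eq_add_of_le ha
      refine ⟨by omega, reach_ne_zero hh hJ hq hφ (by omega), hφ j (by omega), ?_⟩
      have := hdφ j (by omega)
      rw [tangencyDeriv_apply, add_comm] at this
      exact this)
  refine ⟨fun t => ofSeq m k fun s => γ s t, ?_, ?_, ?_, ?_⟩
  · exact conf_ext fun i hi => by rw [joint_ofSeq _ hi, (h1 i).1]
  · rw [hasDerivAt_pi]
    intro i
    rw [← joint_val w i]
    exact (h1 i).2
  · intro s hs t
    rw [joint_ofSeq _ (by omega), h2 s hs]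
  · have h4 : ∀ᶠ t in 𝓝 (0 : ℝ), ∀ s ∈ {s | s < k}, n₀ ≤ s → ‖γ (s + 1) t - γ s t‖ = 1 ∧
        ((h ≤ s ∧ s < h + J) →
          inner ℝ (γ (s + 1) t - γ s t) (γ s t - γ (h - 1) t) = (0 : ℝ)) := by
      rw [eventually_all_finite (Set.finite_lt_nat k)]
      intro s hs
      by_cases hn : n₀ ≤ s
      · filter_upwards [h3 s hn hs] with t ht _ using ht
      · filter_upwards with t h using absurd h hn
    filter_upwards [h4] with t ht
    refine ⟨fun s hs => ?_, fun j hj => ?_⟩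
    · rw [joint_ofSeq _ hs, joint_ofSeq _ hs.le]
      by_cases hn : n₀ ≤ s
      · exact (ht s hs hn).1
      -- Both ends of a rigid bar move with the same velocity along straight lines, so the bar is
      -- merely translated.
      · rw [h2 _ (by omega), h2 _ (by omega)]
        have e := hrigid s (by omega)
        rw [bar, sub_eq_zero] at e
        simpa [e] using hq s hs
    · simp only [tangencyEq]
      rw [joint_ofSeq _ (by omega), joint_ofSeq _ (by omega), joint_ofSeq _ (by omega)]
      exact (ht (h + j) (show h + j < k by omega) (by omega)).2 (by omega)

/-- A differentiable function that vanishes on `S` has a differential that vanishes on the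
tangent space of `S`. -/
lemma hasFDerivAt_eq_zero_of_mem_tangentSpace {E F : Type*} [NormedAddCommGroup E]
    [NormedSpace ℝ E] [NormedAddCommGroup F] [NormedSpace ℝ F] {S : Set E} {q v : E}
    (hv : v ∈ tangentSpace S q) {g : E → F} {g' : E →L[ℝ] F} (hg : HasFDerivAt g g' q)
    (h0 : ∀ᶠ y in 𝓝 q, y ∈ S → g y = 0) : g' v = 0 := by
  have : tangentSpace S q ≤ LinearMap.ker g'.toLinearMap := by
    refine Submodule.span_le.2 ?_
    rintro v ⟨γ, hγ0, hγ, hγS⟩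
    have h1 : HasDerivAt (g ∘ γ) (g' v) 0 := by
      refine HasFDerivAt.comp_hasDerivAt (0 : ℝ) ?_ hγ
      rwa [hγ0]
    have h2 : g ∘ γ =ᶠ[𝓝 0] fun _ => 0 := by
      have : ∀ᶠ t in 𝓝 (0 : ℝ), γ t ∈ S → g (γ t) = 0 :=
        hγ.continuousAt.eventually (by rwa [hγ0])
      filter_upwards [this, hγS] with t ht hS using ht hS
    exact (h1.congr_of_eventuallyEq h2.symm).unique (hasDerivAt_const _ _)
  exact this hv

lemma map_tangentSpace_subset {E F : Type*} [NormedAddCommGroup E]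
    [NormedSpace ℝ E] [NormedAddCommGroup F] [NormedSpace ℝ F] {S : Set E} {T : Set F} {q v : E}
    (hv : v ∈ tangentSpace S q) {g : E → F} {g' : E →L[ℝ] F} (hg : HasFDerivAt g g' q)
    (h0 : ∀ y ∈ S, g y ∈ T) : g' v ∈ tangentSpace T (g q) := by
  have : tangentSpace S q ≤ (tangentSpace T (g q)).comap g'.toLinearMap := by
    refine Submodule.span_le.2 ?_
    rintro v ⟨γ, hγ0, hγ, hγS⟩
    refine Submodule.subset_span ⟨g ∘ γ, by simp [hγ0], ?_, hγS.mono fun t ht => h0 _ ht⟩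
    refine HasFDerivAt.comp_hasDerivAt (0 : ℝ) ?_ hγ
    rwa [hγ0]
  exact this hv

lemma hasFDerivAt_inner_bar_bar (i : ℕ) (q : Conf m k) :
    HasFDerivAt (fun y : Conf m k => inner ℝ (bar y i) (bar y i) - (1 : ℝ))
      ((fderivInnerCLM ℝ (bar q i, bar q i)).comp ((barL m k i).prod (barL m k i))) q :=
  ((hasFDerivAt_bar i q).inner ℝ (hasFDerivAt_bar i q)).sub_const 1

lemma tangentSpace_le_tangentModel {S : Set (Conf m k)} (hS : S ⊆ configSpace m k)
    (q : Conf m k) : tangentSpace S q ≤ tangentModel q := by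
  intro w hw i hi
  have := hasFDerivAt_eq_zero_of_mem_tangentSpace hw (hasFDerivAt_inner_bar_bar i q)
    (Eventually.of_forall fun y hy => by rw [inner_bar_self (hS hy) hi, sub_self])
  simp only [ContinuousLinearMap.comp_apply, ContinuousLinearMap.prod_apply,
    fderivInnerCLM_apply, barL_apply] at this
  rw [real_inner_comm] at this
  linarith

lemma tangencyDeriv_eq_zero {S : Set (Conf m k)} {h j : ℕ} (hS : ∀ y ∈ S, tangencyEq h j y = 0)
    {q w : Conf m k} (hw : w ∈ tangentSpace S q) : tangencyDeriv h j q w = 0 :=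
  hasFDerivAt_eq_zero_of_mem_tangentSpace hw (hasFDerivAt_tangencyEq h j q)
    (Eventually.of_forall hS)

lemma tangentSpace_configSpace {q : Conf m k} (hq : q ∈ configSpace m k) :
    tangentSpace (configSpace m k) q = tangentModel q := by
  refine le_antisymm (tangentSpace_le_tangentModel subset_rfl q) fun w hw => ?_
  -- `exists_curve` needs some h with 1 ≤ h ≤ k; for k = 0 there are no bars and straight lines
  -- suffice.
  rcases Nat.eq_zero_or_pos k with rfl | hk
  · refine Submodule.subset_span ⟨fun t => q + t • w, by simp, ?_, ?_⟩
    · simpa using ((hasDerivAt_id (0 : ℝ)).smul_const w).const_add q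
    · exact Eventually.of_forall fun t i hi => absurd hi (Nat.not_lt_zero i)
  · obtain ⟨γ, h0, h1, -, h2⟩ := exists_curve hq hw (h := 1) (J := 0) le_rfl hk (by simp)
      (by simp) (n₀ := 0) (by simp) (by simp)
    exact Submodule.subset_span ⟨γ, h0, h1, h2.mono fun t ht => ht.1⟩

end Curves

/-! ### Explicit form of the distributions of the flag -/

section Models

variable {m k : ℕ}

/-- The vectors `w` with `w_i = ⟨w_{i+1}, x_{i+1} - x_i⟩ (x_{i+1} - x_i)` for `i < j`. -/
noncomputable def chainModel (j : ℕ) (q : Conf m k) : Submodule ℝ (Conf m k) where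
  carrier := {w | ∀ i < j, joint w i = inner ℝ (joint w (i + 1)) (bar q i) • bar q i}
  add_mem' ha hb i hi := by
    rw [joint_add, joint_add, inner_add_left, add_smul, ← ha i hi, ← hb i hi]
  zero_mem' i _ := by rw [joint_zero, joint_zero, inner_zero_left, zero_smul]
  smul_mem' c a ha i hi := by
    rw [joint_smul, joint_smul, inner_smul_left, RCLike.conj_to_real, mul_smul, ← ha i hi]

/-- The vectors `w` with `w_i = 0` for `i ≤ j`. -/
noncomputable def frozenModel (m k j : ℕ) : Submodule ℝ (Conf m k) where
  carrier := {w | ∀ i ≤ j, joint w i = 0}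
  add_mem' ha hb i hi := by rw [joint_add, ha i hi, hb i hi, add_zero]
  zero_mem' i _ := joint_zero i
  smul_mem' c a ha i hi := by rw [joint_smul, ha i hi, smul_zero]

/-- The explicit form of the member `D_j` of the flag of `𝒟_k`. -/
noncomputable def distModel (j : ℕ) (q : Conf m k) : Submodule ℝ (Conf m k) :=
  tangentModel q ⊓ chainModel j q

/-- The explicit form of `L(D_j)`: the vertical space of `C^k(m) → C^j(m)`. -/
noncomputable def verticalModel (j : ℕ) (q : Conf m k) : Submodule ℝ (Conf m k) :=
  tangentModel q ⊓ frozenModel m k j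

lemma distModel_anti {i j : ℕ} (h : i ≤ j) (q : Conf m k) : distModel j q ≤ distModel i q :=
  fun _ hw => ⟨hw.1, fun s hs => hw.2 s (hs.trans_le h)⟩

lemma verticalModel_anti {i j : ℕ} (h : i ≤ j) (q : Conf m k) :
    verticalModel j q ≤ verticalModel i q :=
  fun _ hw => ⟨hw.1, fun s hs => hw.2 s (hs.trans h)⟩

/-- Once w_s = 0, the bar equation reads ⟨w_{s+1}, u_s⟩ = 0, so the chain relation at s holds with
both sides zero. -/
lemma verticalModel_le_distModel {i j : ℕ} (h : j ≤ i + 1) (q : Conf m k) (hj : j ≤ k) :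
    verticalModel i q ≤ distModel j q := by
  refine fun w hw => ⟨hw.1, fun s hs => ?_⟩
  have h1 := hw.1 s (by omega)
  rw [bar, inner_sub_left, hw.2 s (by omega), inner_zero_left, sub_zero] at h1
  rw [hw.2 s (by omega), h1, zero_smul]

/-- The chain relations determine each component from the next one, so a zero propagates downward.
-/
lemma chain_eq_zero {j : ℕ} {q w : Conf m k} (hw : w ∈ chainModel j q) (h0 : joint w j = 0) :
    ∀ i ≤ j, joint w i = 0 := by
  intro i hi
  induction hi using Nat.decreasingInduction with
  | self => exact h0
  | of_succ i hi ih => rw [hw i hi, ih, inner_zero_left, zero_smul]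

lemma mem_verticalModel_of_joint_eq_zero {j : ℕ} {q w : Conf m k} (hw : w ∈ distModel j q)
    (h0 : joint w j = 0) : w ∈ verticalModel j q :=
  ⟨hw.1, chain_eq_zero hw.2 h0⟩

/-- Being parallel to the bar is enough: the length equation then fixes the coefficient to be the
one of the chain relation. -/
lemma mem_distModel_succ {j : ℕ} (hj : j < k) {q w : Conf m k} (hq : q ∈ configSpace m k)
    (hw : w ∈ distModel j q) {c : ℝ} (hc : joint w j = c • bar q j) : w ∈ distModel (j + 1) q := by
  refine ⟨hw.1, fun i hi => ?_⟩
  rcases Nat.lt_succ_iff_lt_or_eq.1 hi with hi | rfl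
  · exact hw.2 i hi
  · have h1 := hw.1 i hj
    rw [bar, inner_sub_left, hc, inner_smul_left, inner_bar_self hq hj, sub_eq_zero] at h1
    rw [h1, hc]; simp

lemma mem_kinematicDist {q w : Conf m k} : w ∈ kinematicDist q ↔
    ∀ i < k, ∃ c : ℝ, joint w i = c • bar q i := by
  constructor
  · intro hw i hi
    have : kinematicDist q ≤ (Submodule.span ℝ {bar q i}).comap (jointL m k i).toLinearMap := by
      refine Submodule.span_le.2 ?_
      rintro _ (⟨s, rfl⟩ | ⟨e, rfl⟩)
      · simp only [Submodule.comap_coe, Set.mem_preimage, ContinuousLinearMap.coe_coe,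
          jointL_apply, SetLike.mem_coe, fieldZ]
        rw [joint_of_le _ hi.le]
        by_cases his : (⟨i, Nat.lt_succ_of_le hi.le⟩ : Fin (k + 1)) = s.castSucc
        · rw [his, Pi.single_eq_same]
          refine Submodule.mem_span_singleton.2 ⟨1, ?_⟩
          obtain rfl : i = s := congrArg Fin.val his
          rw [one_smul, bar, joint_of_le _ hi, joint_of_le _ hi.le]
          rfl
        · rw [Pi.single_eq_of_ne his]; exact zero_mem _
      · simp only [Submodule.comap_coe, Set.mem_preimage, ContinuousLinearMap.coe_coe,
          jointL_apply, SetLike.mem_coe]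
        rw [joint_of_le _ hi.le, Pi.single_eq_of_ne (by
          intro h; have := congrArg Fin.val h; simp at this; omega)]
        exact zero_mem _
    obtain ⟨c, hc⟩ := Submodule.mem_span_singleton.1 (this hw)
    exact ⟨c, by simpa [jointL_apply] using hc.symm⟩
  · intro hw
    have h1 : w = ∑ i, Pi.single i (w i) := (Finset.univ_sum_single w).symm
    rw [h1, Fin.sum_univ_castSucc]
    refine add_mem (sum_mem fun i _ => ?_) (Submodule.subset_span (Or.inr ⟨_, rfl⟩))
    obtain ⟨c, hc⟩ := hw i i.2
    have h2 : Pi.single i.castSucc (w i.castSucc) = c • fieldZ q i := by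
      rw [fieldZ, ← Pi.single_smul, ← joint_val w, ← joint_val q, ← joint_val q]
      congr 1
    rw [h2]
    exact Submodule.smul_mem _ _ (Submodule.subset_span (Or.inl ⟨_, rfl⟩))

lemma armDist_eq {q : Conf m k} (hq : q ∈ configSpace m k) : armDist m k q = distModel k q := by
  rw [armDist, tangentSpace_configSpace hq]
  refine le_antisymm ?_ ?_
  · intro w hw
    refine ⟨hw.1, fun i hi => ?_⟩
    obtain ⟨c, hc⟩ := mem_kinematicDist.1 hw.2 i hi
    have h1 := hw.1 i hi
    rw [bar, inner_sub_left, hc, inner_smul_left, inner_bar_self hq hi, sub_eq_zero] at h1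
    rw [h1, hc]; simp
  · intro w hw
    exact ⟨hw.1, mem_kinematicDist.2 fun i hi => ⟨_, hw.2 i hi⟩⟩

/-! ### Global sections -/

/-- Descending recursion: the induction replaces the top field e by its projection to the bar below
it. Values of X above index n are irrelevant. -/
lemma exists_chain_fields (n : ℕ) (e : Conf m k → EuclideanSpace ℝ (Fin (m + 1)))
    (he : ContDiff ℝ ∞ e) :
    ∃ X : ℕ → Conf m k → EuclideanSpace ℝ (Fin (m + 1)), (∀ i, ContDiff ℝ ∞ (X i)) ∧ X n = e ∧
      ∀ i < n, ∀ y, X i y = inner ℝ (X (i + 1) y) (bar y i) • bar y i := by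
  induction n generalizing e with
  | zero => exact ⟨fun _ => e, fun _ => he, rfl, fun i hi => by omega⟩
  | succ n ih =>
    obtain ⟨X, h1, h2, h3⟩ := ih (fun y => inner ℝ (e y) (bar y n) • bar y n)
      ((he.inner ℝ (contDiff_bar n)).smul (contDiff_bar n))
    refine ⟨Function.update X (n + 1) e, fun i => ?_, Function.update_self .., fun i hi y => ?_⟩
    · by_cases hi : i = n + 1
      · subst hi; rwa [Function.update_self]
      · rw [Function.update_of_ne hi]; exact h1 i
    · rw [Function.update_of_ne (by omega : i ≠ n + 1)]
      rcases Nat.lt_succ_iff_lt_or_eq.1 hi with hi | rfl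
      · rw [Function.update_of_ne (by omega : i + 1 ≠ n + 1)]; exact h3 i hi y
      · rw [Function.update_self, h2]

/-- A section of D_j is freely determined by its component along x_j and by the bar velocities above
j. Here the former is the constant e, the latter are constants a_i made orthogonal to the bars, and
the components below come from the chain. The formulas are smooth on the whole ambient space, so no
localization is needed. -/
lemma exists_section {j : ℕ} (hj : j ≤ k) (e : EuclideanSpace ℝ (Fin (m + 1)))
    (a : ℕ → EuclideanSpace ℝ (Fin (m + 1))) :
    ∃ X : Conf m k → Conf m k, ContDiff ℝ ∞ X ∧ (∀ y, joint (X y) j = e) ∧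
      (∀ y ∈ configSpace m k, X y ∈ distModel j y) ∧
      ∀ y i, j ≤ i → i < k → bar (X y) i = a i - inner ℝ (a i) (bar y i) • bar y i := by
  obtain ⟨X, h1, h2, h3⟩ := exists_chain_fields (m := m) (k := k) j (fun _ => e) contDiff_const
  let Y : ℕ → Conf m k → EuclideanSpace ℝ (Fin (m + 1)) := fun i y =>
    e + ∑ s ∈ Finset.Ico j i, (a s - inner ℝ (a s) (bar y s) • bar y s)
  have hY : ∀ i, ContDiff ℝ ∞ (Y i) := fun i =>
    contDiff_const.add (ContDiff.sum fun s _ =>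
      contDiff_const.sub ((contDiff_const.inner ℝ (contDiff_bar s)).smul (contDiff_bar s)))
  let Z : Conf m k → Conf m k := fun y => ofSeq m k fun i => if i ≤ j then X i y else Y i y
  have hZ1 : ∀ y i, i ≤ j → joint (Z y) i = X i y := fun y i hi => by
    simp only [Z]; rw [joint_ofSeq _ (hi.trans hj), if_pos hi]
  have hZ2 : ∀ y i, j ≤ i → i ≤ k → joint (Z y) i = Y i y := fun y i hi hik => by
    rcases hi.eq_or_lt with rfl | hi
    · rw [hZ1 y j le_rfl, h2]; simp [Y]
    · simp only [Z]; rw [joint_ofSeq _ hik, if_neg (by omega)]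
  have hbar : ∀ y i, j ≤ i → i < k → bar (Z y) i = a i - inner ℝ (a i) (bar y i) • bar y i := by
    intro y i hi hik
    rw [bar, hZ2 y _ (by omega) hik, hZ2 y i hi hik.le]
    simp only [Y]
    rw [Finset.sum_Ico_succ_top hi]; abel
  have hchain : ∀ y, Z y ∈ chainModel j y := fun y i hi => by
    rw [hZ1 y i hi.le, hZ1 y _ hi]; exact h3 i hi y
  refine ⟨Z, ?_, fun y => by rw [hZ1 y j le_rfl, h2], fun y hy => ⟨fun i hi => ?_, hchain y⟩, hbar⟩
  · rw [contDiff_pi]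
    intro i
    by_cases hi : (i : ℕ) ≤ j
    · simpa [Z, ofSeq, hi] using h1 i
    · simpa [Z, ofSeq, hi] using hY i
  · by_cases hij : j ≤ i
    · rw [hbar y i hij hi, inner_sub_left, inner_smul_left, inner_bar_self hy hi]; simp
    · rw [bar, inner_sub_left, hchain y i (by omega), inner_smul_left, inner_bar_self hy hi]; simp

/-- Two vectors of `D_j` with the same components along `x_j` and the bars above coincide. -/
lemma eq_of_mem_distModel {j : ℕ} {q v w : Conf m k}
    (hv : v ∈ distModel j q) (hw : w ∈ distModel j q) (hj : joint v j = joint w j)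
    (hb : ∀ i, j ≤ i → i < k → bar v i = bar w i) : v = w := by
  have h1 : ∀ i ≤ j, joint (v - w) i = 0 :=
    chain_eq_zero (sub_mem hv.2 hw.2) (by rw [joint_sub, hj, sub_self])
  refine conf_ext fun i => ?_
  by_cases hij : i ≤ j
  · intro _; simpa [joint_sub, sub_eq_zero] using h1 i hij
  · obtain ⟨s, rfl⟩ := Nat.exists_eq_add_of_le (Nat.le_of_not_le hij)
    clear hij
    induction s with
    | zero => intro _; simpa using hj
    | succ s ih =>
      intro hs
      rw [← add_assoc, joint_succ, joint_succ, ih (by omega), hb (j + s) (by omega) (by omega)]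

lemma exists_section_eq {j : ℕ} (hj : j ≤ k) {q w : Conf m k} (hq : q ∈ configSpace m k)
    (hw : w ∈ distModel j q) :
    ∃ X : Conf m k → Conf m k, ContDiff ℝ ∞ X ∧ X q = w ∧ (∀ y, joint (X y) j = joint w j) ∧
      ∀ y ∈ configSpace m k, X y ∈ distModel j y := by
  -- At q the bar velocities of w are already orthogonal to the bars, so the projection in
  -- `exists_section` leaves them unchanged.
  obtain ⟨X, h1, h2, h3, h4⟩ := exists_section (m := m) hj (joint w j) (bar w)
  refine ⟨X, h1, eq_of_mem_distModel (h3 q hq) hw (h2 q) fun i hi hik => ?_, h2, h3⟩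
  rw [h4 q i hi hik, hw.1 i hik, zero_smul, sub_zero]

lemma exists_mem_distModel {j : ℕ} (hj : j ≤ k) {q : Conf m k} (hq : q ∈ configSpace m k)
    (e : EuclideanSpace ℝ (Fin (m + 1))) :
    ∃ w ∈ distModel j q, joint w j = e := by
  obtain ⟨X, -, h2, h3, -⟩ := exists_section (m := m) hj e 0
  exact ⟨X q, h3 q hq, h2 q⟩

lemma exists_distModel_of_orthogonal {j : ℕ} (hj : j < k) {q : Conf m k}
    (hq : q ∈ configSpace m k) {e : EuclideanSpace ℝ (Fin (m + 1))}
    (he : inner ℝ e (bar q j) = (0 : ℝ)) :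
    ∃ w ∈ verticalModel j q, joint w (j + 1) = e := by
  obtain ⟨X, -, h2, h3, h4⟩ := exists_section (m := m) hj.le 0 (fun _ => e)
  refine ⟨X q, mem_verticalModel_of_joint_eq_zero (h3 q hq) (h2 q), ?_⟩
  rw [joint_succ, h2, h4 q j le_rfl hj, he]; simp

/-! ### Brackets -/

lemma IsLocalSection.hasFDerivAt {E : Type*} [NormedAddCommGroup E] [NormedSpace ℝ E] {M : Set E}
    {D : E → Submodule ℝ E} {U : Set E} {X : E → E} (hX : IsLocalSection M D U X) {q : E}
    (hq : q ∈ U) : HasFDerivAt X (fderiv ℝ X q) q :=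
  ((hX.smooth.contDiffAt (hX.isOpen.mem_nhds hq)).differentiableAt (by simp)).hasFDerivAt

lemma IsLocalSection.eventually {E : Type*} [NormedAddCommGroup E] [NormedSpace ℝ E] {M : Set E}
    {D : E → Submodule ℝ E} {U : Set E} {X : E → E} (hX : IsLocalSection M D U X) {q : E}
    (hq : q ∈ U) : ∀ᶠ y in 𝓝 q, y ∈ M → X y ∈ D y := by
  filter_upwards [hX.isOpen.mem_nhds hq] with y hy hM using hX.tangent y ⟨hy, hM⟩

lemma IsLocalSection.mono {E : Type*} [NormedAddCommGroup E] [NormedSpace ℝ E] {M : Set E}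
    {D D' : E → Submodule ℝ E} {U : Set E} {X : E → E} (hX : IsLocalSection M D U X)
    (h : ∀ y ∈ M, D y ≤ D' y) : IsLocalSection M D' U X :=
  ⟨hX.isOpen, hX.smooth, fun y hy => h y hy.2 (hX.tangent y hy)⟩

lemma isLocalSection_univ {E : Type*} [NormedAddCommGroup E] [NormedSpace ℝ E] {M : Set E}
    {D : E → Submodule ℝ E} {X : E → E} (hX : ContDiff ℝ ∞ X) (h : ∀ y ∈ M, X y ∈ D y) :
    IsLocalSection M D Set.univ X :=
  ⟨isOpen_univ, hX.contDiffOn, fun y hy => h y hy.2⟩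

variable {X Y : Conf m k → Conf m k} {U V : Set (Conf m k)} {q : Conf m k}
  {D : Conf m k → Submodule ℝ (Conf m k)}

lemma hasFDerivAt_joint_comp {X' : Conf m k →L[ℝ] Conf m k} (hX : HasFDerivAt X X' q) (i : ℕ) :
    HasFDerivAt (fun y => joint (X y) i) ((jointL m k i).comp X') q :=
  (hasFDerivAt_joint i (X q)).comp q hX

lemma hasFDerivAt_bar_comp {X' : Conf m k →L[ℝ] Conf m k} (hX : HasFDerivAt X X' q) (i : ℕ) :
    HasFDerivAt (fun y => bar (X y) i) ((barL m k i).comp X') q :=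
  (hasFDerivAt_bar i (X q)).comp q hX

/-- Differentiate ⟨bar X, bar⟩ = 0 along v. The identity holds on the configuration space only,
which suffices because v is tangent to it. -/
lemma inner_bar_fderiv (hX : IsLocalSection (configSpace m k) tangentModel U X) (hU : q ∈ U)
    (hq : q ∈ configSpace m k) {v : Conf m k} (hv : v ∈ tangentModel q) {i : ℕ} (hi : i < k) :
    inner ℝ (bar (fderiv ℝ X q v) i) (bar q i) + inner ℝ (bar (X q) i) (bar v i) = (0 : ℝ) := by
  rw [← tangentSpace_configSpace hq] at hv
  have := hasFDerivAt_eq_zero_of_mem_tangentSpace hv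
    ((hasFDerivAt_bar_comp (hX.hasFDerivAt hU) i).inner ℝ (hasFDerivAt_bar i q))
    ((hX.eventually hU).mono fun y hy hM => hy hM i hi)
  simpa only [ContinuousLinearMap.comp_apply, ContinuousLinearMap.prod_apply,
    fderivInnerCLM_apply, barL_apply, add_comm] using this

lemma joint_fderiv_eq_zero {i : ℕ} (hX : IsLocalSection (configSpace m k) D U X) (hU : q ∈ U)
    (hD : ∀ y ∈ configSpace m k, ∀ w ∈ D y, joint w i = 0)
    (hq : q ∈ configSpace m k) {v : Conf m k} (hv : v ∈ tangentModel q) :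
    joint (fderiv ℝ X q v) i = 0 := by
  rw [← tangentSpace_configSpace hq] at hv
  have := hasFDerivAt_eq_zero_of_mem_tangentSpace hv (hasFDerivAt_joint_comp (hX.hasFDerivAt hU) i)
    ((hX.eventually hU).mono fun y hy hM => hD y hM _ (hy hM))
  simpa only [ContinuousLinearMap.comp_apply, jointL_apply] using this

/-- Differentiate the chain relation. The derivative of its scalar coefficient only contributes a
multiple of the bar, hidden in r; later arguments need the result only modulo the bar. -/
lemma joint_fderiv {j : ℕ} (hX : IsLocalSection (configSpace m k) (distModel j) U X) (hU : q ∈ U)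
    (hq : q ∈ configSpace m k) {v : Conf m k} (hv : v ∈ tangentModel q) {i : ℕ} (hi : i < j) :
    ∃ r : ℝ, joint (fderiv ℝ X q v) i =
      r • bar q i + inner ℝ (joint (X q) (i + 1)) (bar q i) • bar v i := by
  rw [← tangentSpace_configSpace hq] at hv
  have hd := hX.hasFDerivAt hU
  have := hasFDerivAt_eq_zero_of_mem_tangentSpace hv
    ((hasFDerivAt_joint_comp hd i).sub
      (((hasFDerivAt_joint_comp hd (i + 1)).inner ℝ (hasFDerivAt_bar i q)).smul
        (hasFDerivAt_bar i q)))
    ((hX.eventually hU).mono fun y hy hM => sub_eq_zero.2 ((hy hM).2 i hi))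
  simp only [_root_.sub_apply, ContinuousLinearMap.comp_apply,
    _root_.add_apply, _root_.smul_apply,
    ContinuousLinearMap.smulRight_apply, jointL_apply, barL_apply, sub_eq_zero] at this
  exact ⟨_, this.trans (add_comm _ _)⟩

/-- The two second-order terms both equal the inner product of the bar velocities of X and Y, and
cancel by symmetry. -/
lemma lieBracket_mem_tangentModel (hX : IsLocalSection (configSpace m k) tangentModel U X)
    (hY : IsLocalSection (configSpace m k) tangentModel V Y) (hU : q ∈ U) (hV : q ∈ V)
    (hq : q ∈ configSpace m k) : VectorField.lieBracket ℝ X Y q ∈ tangentModel q := by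
  intro i hi
  have h1 := inner_bar_fderiv hX hU hq (hY.tangent q ⟨hV, hq⟩) hi
  have h2 := inner_bar_fderiv hY hV hq (hX.tangent q ⟨hU, hq⟩) hi
  rw [VectorField.lieBracket, bar_sub, inner_sub_left]
  rw [real_inner_comm] at h1 h2
  rw [real_inner_comm (bar (X q) i)] at h2
  linarith [real_inner_comm (bar (fderiv ℝ X q (Y q)) i) (bar q i),
    real_inner_comm (bar (fderiv ℝ Y q (X q)) i) (bar q i)]

/-- The basic bracket formula modulo u_i, from which the Lie squares, the Cauchy characteristics and
the uniqueness of the integrable hyperplane field are all read off. -/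
lemma joint_lieBracket {j : ℕ} (hX : IsLocalSection (configSpace m k) (distModel j) U X)
    (hY : IsLocalSection (configSpace m k) (distModel j) V Y) (hU : q ∈ U) (hV : q ∈ V)
    (hq : q ∈ configSpace m k) {i : ℕ} (hi : i < j) :
    ∃ r : ℝ, joint (VectorField.lieBracket ℝ X Y q) i = r • bar q i +
      (inner ℝ (joint (Y q) (i + 1)) (bar q i) • bar (X q) i -
        inner ℝ (joint (X q) (i + 1)) (bar q i) • bar (Y q) i) := by
  obtain ⟨r, hr⟩ := joint_fderiv hX hU hq (hY.tangent q ⟨hV, hq⟩).1 hi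
  obtain ⟨s, hs⟩ := joint_fderiv hY hV hq (hX.tangent q ⟨hU, hq⟩).1 hi
  refine ⟨s - r, ?_⟩
  rw [VectorField.lieBracket, joint_sub, hr, hs]
  module

end Models

/-! ### The sandwich flag of the articulated arm -/

section Congruence

variable {E : Type*} [NormedAddCommGroup E] [NormedSpace ℝ E] {M : Set E}
  {D D' : E → Submodule ℝ E}

/-- The explicit models agree with the members of the flag only at points of the configuration
space; this lemma and the next three show that the constructions see nothing else. -/
lemma isLocalSection_congr (h : ∀ y ∈ M, D y = D' y) :
    IsLocalSection M D = IsLocalSection M D' := by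
  funext U X
  exact propext ⟨fun hX => hX.mono fun y hy => (h y hy).le,
    fun hX => hX.mono fun y hy => (h y hy).ge⟩

lemma lieSquare_congr (h : ∀ y ∈ M, D y = D' y) : lieSquare M D = lieSquare M D' := by
  funext q
  simp only [lieSquare, isLocalSection_congr h]

lemma cauchyCharacteristic_congr (h : ∀ y ∈ M, D y = D' y) {q : E} :
    cauchyCharacteristic M D q = cauchyCharacteristic M D' q := by
  unfold cauchyCharacteristic
  rw [isLocalSection_congr h]
  have : ∀ (U : Set E) (X : E → E), (∀ V Y, IsLocalSection M D' V Y → ∀ y ∈ U ∩ V ∩ M,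
      VectorField.lieBracket ℝ X Y y ∈ D y) ↔ (∀ V Y, IsLocalSection M D' V Y → ∀ y ∈ U ∩ V ∩ M,
      VectorField.lieBracket ℝ X Y y ∈ D' y) := fun U X =>
    forall₃_congr fun V Y _ => forall₂_congr fun y hy => by rw [h y hy.2]
  simp only [this]

lemma integrableCorankOne_congr (h : ∀ y ∈ M, D y = D' y) :
    integrableCorankOne M D = integrableCorankOne M D' := by
  have key : ∀ {D D' : E → Submodule ℝ E}, (∀ y ∈ M, D y = D' y) →
      ∀ F, IsIntegrableCorankOne M D F → IsIntegrableCorankOne M D' F := fun h F hF =>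
    ⟨fun q hq => h q hq ▸ hF.le q hq, fun q hq => h q hq ▸ hF.corank q hq, hF.smooth, hF.involutive⟩
  funext q
  unfold integrableCorankOne
  congr 1; funext F
  rw [propext ⟨key h F, key (fun y hy => (h y hy).symm) F⟩]

end Congruence

/-! ### Computation of the flag, of its characteristics and of the Cartan points -/

section Flag

variable {m k : ℕ}

lemma distModel_le_tangentModel (j : ℕ) (q : Conf m k) : distModel j q ≤ tangentModel q :=
  inf_le_left

lemma lieBracket_mem_distModel {j : ℕ} {X Y : Conf m k → Conf m k} {U V : Set (Conf m k)}
    {q : Conf m k} (hj : j + 1 ≤ k) (hX : IsLocalSection (configSpace m k) (distModel (j + 1)) U X)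
    (hY : IsLocalSection (configSpace m k) (distModel (j + 1)) V Y) (hU : q ∈ U) (hV : q ∈ V)
    (hq : q ∈ configSpace m k) : VectorField.lieBracket ℝ X Y q ∈ distModel j q := by
  have ht := lieBracket_mem_tangentModel (hX.mono fun y _ => distModel_le_tangentModel _ y)
    (hY.mono fun y _ => distModel_le_tangentModel _ y) hU hV hq
  refine ⟨ht, fun i hi => ?_⟩
  obtain ⟨r, hr⟩ := joint_lieBracket hX hY hU hV hq (i := i) (by omega)
  have hx := hX.tangent q ⟨hU, hq⟩
  have hy := hY.tangent q ⟨hV, hq⟩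
  obtain ⟨a, ha⟩ : ∃ a : ℝ, joint (X q) (i + 1) = a • bar q (i + 1) := ⟨_, hx.2 (i + 1) (by omega)⟩
  obtain ⟨b, hb⟩ : ∃ b : ℝ, joint (Y q) (i + 1) = b • bar q (i + 1) := ⟨_, hy.2 (i + 1) (by omega)⟩
  -- For i < j both fields have (i+1)-components parallel to u_{i+1}, so the antisymmetric
  -- expression in the bracket formula vanishes. For i = j this parallelism is missing, and exactly
  -- that chain relation can be lost.
  obtain ⟨c, hc⟩ : ∃ c : ℝ, joint (VectorField.lieBracket ℝ X Y q) i = c • bar q i := by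
    refine ⟨r, ?_⟩
    rw [hr, bar_eq (X q), bar_eq (Y q), hx.2 i (by omega), hy.2 i (by omega), ha, hb]
    simp only [inner_smul_left, RCLike.conj_to_real]
    module
  have h1 := ht i (by omega)
  rw [bar, inner_sub_left, hc, inner_smul_left, inner_bar_self hq (by omega), sub_eq_zero] at h1
  rw [h1, hc]; simp

lemma lieSquare_distModel {j : ℕ} (hj : j + 1 ≤ k) {q : Conf m k} (hq : q ∈ configSpace m k) :
    lieSquare (configSpace m k) (distModel (j + 1)) q = distModel j q := by
  refine le_antisymm (Submodule.span_le.2 ?_) fun w hw => ?_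
  · rintro v (⟨U, X, hX, hU, rfl⟩ | ⟨U, X, Y, hX, hY, hU, rfl⟩)
    · exact distModel_anti (Nat.le_succ j) q (hX.tangent q ⟨hU, hq⟩)
    · exact lieBracket_mem_distModel hj hX hY hU hU hq
  · set u := bar q j with hu
    have huu : inner ℝ u u = (1 : ℝ) := inner_bar_self hq hj
    set e := joint w j - inner ℝ (joint w j) u • u with he
    have heu : inner ℝ e u = (0 : ℝ) := by
      rw [he, inner_sub_left, inner_smul_left, huu]; simp
    -- Let e be the part of w_j orthogonal to u. With (j+1)-components u and -e, the bracket has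
    -- j-component e modulo u, so subtracting it from w leaves a vector whose j-component is
    -- parallel to u, that is, an element of D_{j+1}.
    obtain ⟨X, hX, hX1, hX2, -⟩ := exists_section (m := m) hj u 0
    obtain ⟨Y, hY, hY1, hY2, -⟩ := exists_section (m := m) hj (-e) 0
    have hXs := isLocalSection_univ hX hX2
    have hYs := isLocalSection_univ hY hY2
    have hb := lieBracket_mem_distModel hj hXs hYs (Set.mem_univ q) (Set.mem_univ q) hq
    obtain ⟨r, hr⟩ := joint_lieBracket hXs hYs (Set.mem_univ q) (Set.mem_univ q) hq
      (Nat.lt_succ_self j)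
    have hYj : joint (Y q) j = 0 := by
      rw [(hY2 q hq).2 j (Nat.lt_succ_self j), hY1, inner_neg_left, heu]; simp
    have hXj : joint (X q) j = u := by
      rw [(hX2 q hq).2 j (Nat.lt_succ_self j), hX1, huu, one_smul]
    rw [bar_eq (X q), bar_eq (Y q), hX1, hY1, hYj, hXj, inner_neg_left, heu, huu] at hr
    have hw' : w - VectorField.lieBracket ℝ X Y q ∈ distModel (j + 1) q := by
      refine mem_distModel_succ hj hq (sub_mem hw hb)
        (c := inner ℝ (joint w j) u - r) ?_
      rw [joint_sub, hr, he, ← hu]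
      module
    rw [← sub_add_cancel w (VectorField.lieBracket ℝ X Y q)]
    refine add_mem ?_ (Submodule.subset_span (Or.inr ⟨_, X, Y, hXs, hYs, Set.mem_univ q, rfl⟩))
    obtain ⟨Z, hZ, hZq, -, hZs⟩ := exists_section_eq hj hq hw'
    exact Submodule.subset_span (Or.inl ⟨_, Z, isLocalSection_univ hZ hZs, Set.mem_univ q, hZq⟩)

lemma flag_eq {j : ℕ} (hj : j ≤ k) : ∀ q ∈ configSpace m k,
    flag (configSpace m k) (armDist m k) k j q = distModel j q := by
  suffices h : ∀ s ≤ k, ∀ q ∈ configSpace m k,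
      (lieSquare (configSpace m k))^[s] (armDist m k) q = distModel (k - s) q by
    intro q hq
    have := h (k - j) (Nat.sub_le _ _) q hq
    rwa [Nat.sub_sub_self hj] at this
  intro s
  induction s with
  | zero => intro _ q hq; exact armDist_eq hq
  | succ s ih =>
    intro hs q hq
    rw [Function.iterate_succ_apply', lieSquare_congr (ih (by omega)),
      show k - s = k - (s + 1) + 1 by omega, lieSquare_distModel (by omega) hq]

lemma exists_unit_orthogonal (hm : 1 ≤ m) (u : EuclideanSpace ℝ (Fin (m + 1))) :
    ∃ e : EuclideanSpace ℝ (Fin (m + 1)), ‖e‖ = 1 ∧ inner ℝ e u = (0 : ℝ) := by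
  have h1 : (Submodule.span ℝ {u})ᗮ ≠ ⊥ := by
    intro h0
    have h2 := Submodule.finrank_add_finrank_orthogonal (Submodule.span ℝ {u})
    rw [h0, finrank_bot, finrank_euclideanSpace_fin] at h2
    have h3 := finrank_span_le_card (R := ℝ) ({u} : Set (EuclideanSpace ℝ (Fin (m + 1))))
    simp at h3
    omega
  obtain ⟨e, he, he0⟩ := Submodule.exists_mem_ne_zero_of_ne_bot h1
  refine ⟨‖e‖⁻¹ • e, ?_, ?_⟩
  · rw [norm_smul, norm_inv, norm_norm, inv_mul_cancel₀ (norm_ne_zero_iff.2 he0)]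
  · rw [inner_smul_left, real_inner_comm,
      (Submodule.mem_orthogonal_singleton_iff_inner_right.1 he), mul_zero]

lemma exists_orthogonal_pair (hm : 2 ≤ m) (u : EuclideanSpace ℝ (Fin (m + 1))) :
    ∃ e f : EuclideanSpace ℝ (Fin (m + 1)), inner ℝ e u = (0 : ℝ) ∧ inner ℝ f u = (0 : ℝ) ∧
      ∀ a b : ℝ, a • e + b • f = 0 → a = 0 ∧ b = 0 := by
  set K := (Submodule.span ℝ {u})ᗮ with hK
  have h1 : 1 < Module.finrank ℝ K := by
    have h2 := Submodule.finrank_add_finrank_orthogonal (Submodule.span ℝ {u})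
    rw [finrank_euclideanSpace_fin, ← hK] at h2
    have h3 := finrank_span_le_card (R := ℝ) ({u} : Set (EuclideanSpace ℝ (Fin (m + 1))))
    simp at h3
    omega
  have : Nontrivial K := Module.nontrivial_of_finrank_pos (R := ℝ) (by omega)
  obtain ⟨x, hx⟩ := exists_ne (0 : K)
  obtain ⟨y, hy⟩ := exists_linearIndependent_pair_of_one_lt_finrank h1 hx
  have hort : ∀ z : K, inner ℝ (z : EuclideanSpace ℝ (Fin (m + 1))) u = (0 : ℝ) := fun z => by
    rw [real_inner_comm]
    exact Submodule.mem_orthogonal_singleton_iff_inner_right.1 z.2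
  refine ⟨x, y, hort x, hort y, fun a b hab => ?_⟩
  rw [LinearIndependent.pair_iff] at hy
  exact hy a b (Subtype.ext (by simpa using hab))

/-- A characteristic field is tested against sections with constant (j+1)-component e. A unit e
orthogonal to u_j shows that X_{j+1} is orthogonal to u_j; then e = u_j shows that it is parallel to
u_j, hence zero. Conversely, for a field freezing the joints up to j + 1 the bracket formula leaves
only a multiple of u_j. -/
lemma cauchyCharacteristic_distModel (hm : 1 ≤ m) {j : ℕ} (hj : j + 1 ≤ k) {q : Conf m k}
    (hq : q ∈ configSpace m k) :
    cauchyCharacteristic (configSpace m k) (distModel (j + 1)) q = verticalModel (j + 1) q := by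
  refine le_antisymm (Submodule.span_le.2 ?_) fun w hw => ?_
  · rintro v ⟨U, X, hX, hU, rfl, hXY⟩
    have hx := hX.tangent q ⟨hU, hq⟩
    refine mem_verticalModel_of_joint_eq_zero hx ?_
    set u := bar q j with hu
    have huu : inner ℝ u u = (1 : ℝ) := inner_bar_self hq hj
    -- If the bracket stays in D_{j+1}, its j-component is a multiple of u, so the rest of the
    -- bracket formula is one too.
    have key : ∀ e, ∃ r : ℝ, r • u = inner ℝ e u • bar (X q) j -
        inner ℝ (joint (X q) (j + 1)) u • (e - inner ℝ e u • u) := by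
      intro e
      obtain ⟨Y, hY, hY1, hY2, -⟩ := exists_section (m := m) hj e 0
      have hYs := isLocalSection_univ hY hY2
      obtain ⟨r, hr⟩ := joint_lieBracket hX hYs hU (Set.mem_univ q) hq (Nat.lt_succ_self j)
      have h1 := (hXY _ Y hYs q ⟨⟨hU, Set.mem_univ q⟩, hq⟩).2 j (Nat.lt_succ_self j)
      have h2 : bar (Y q) j = e - inner ℝ e u • u := by
        rw [bar, (hY2 q hq).2 j (Nat.lt_succ_self j), hY1]
      rw [h2, hY1, h1, ← hu] at hr
      refine ⟨inner ℝ (joint (VectorField.lieBracket ℝ X Y q) (j + 1)) u - r, ?_⟩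
      rw [sub_smul, hr]; abel
    obtain ⟨e, he1, heu⟩ := exists_unit_orthogonal hm u
    have hc : inner ℝ (joint (X q) (j + 1)) u = (0 : ℝ) := by
      obtain ⟨r, hr⟩ := key e
      rw [heu, zero_smul, zero_sub, zero_smul, sub_zero] at hr
      have h3 := congrArg (fun z => inner ℝ z e) hr
      simp only [inner_smul_left, inner_neg_left, real_inner_self_eq_norm_sq, he1] at h3
      rw [real_inner_comm, heu] at h3
      simpa using h3.symm
    obtain ⟨r, hr⟩ := key u
    have hxj : bar (X q) j = joint (X q) (j + 1) := by
      rw [bar, hx.2 j (Nat.lt_succ_self j), ← hu, hc, zero_smul, sub_zero]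
    rw [huu, hc, zero_smul, sub_zero, one_smul, hxj] at hr
    rw [← hr, inner_smul_left, huu] at hc
    rw [← hr]
    have : r = 0 := by simpa using hc
    rw [this, zero_smul]
  · obtain ⟨X, hX, hXq, hX1, hX2⟩ := exists_section_eq hj hq
      (verticalModel_le_distModel (Nat.le_succ _) q hj hw)
    have hXv : ∀ y ∈ configSpace m k, ∀ i ≤ j + 1, joint (X y) i = 0 := fun y hy =>
      chain_eq_zero (hX2 y hy).2 (by rw [hX1, hw.2 _ le_rfl])
    have hXs := isLocalSection_univ hX hX2
    refine Submodule.subset_span ⟨_, X, hXs, Set.mem_univ q, hXq, fun V Y hY y hy => ?_⟩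
    have hyM := hy.2
    have hb := lieBracket_mem_distModel hj hXs hY (Set.mem_univ y) hy.1.2 hyM
    obtain ⟨r, hr⟩ := joint_lieBracket hXs hY (Set.mem_univ y) hy.1.2 hyM (Nat.lt_succ_self j)
    rw [bar_eq (X y), hXv y hyM _ le_rfl, hXv y hyM _ (Nat.le_succ j), sub_zero, smul_zero,
      inner_zero_left, zero_smul, sub_zero, add_zero] at hr
    exact mem_distModel_succ hj hyM hb hr

lemma distModel_one_inf_ker {q : Conf m k} (hk : 1 ≤ k) (hq : q ∈ configSpace m k) {w : Conf m k}
    (hw : w ∈ distModel 1 q) (h0 : inner ℝ (bar q 0) (joint w 0) = (0 : ℝ)) :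
    w ∈ verticalModel 0 q := by
  refine ⟨hw.1, fun i hi => ?_⟩
  obtain rfl : i = 0 := by omega
  have h1 := hw.2 0 one_pos
  rw [h1, inner_smul_right, inner_bar_self hq hk, mul_one] at h0
  rw [h1, h0, zero_smul]

/-- Within D_1, freezing x_0 is the single equation ⟨u_0, w_0⟩ = 0, whose left side is 1 on a vector
with w_1 = u_0. Involutivity holds because the component along x_0 vanishes identically on the
space. -/
lemma isIntegrableCorankOne_verticalModel (hk : 1 ≤ k) :
    IsIntegrableCorankOne (configSpace m k) (distModel 1) (verticalModel (m := m) 0) where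
  le q _ := verticalModel_le_distModel le_rfl q hk
  corank q hq := by
    set f : distModel 1 q →ₗ[ℝ] ℝ :=
      (((innerSL ℝ (bar q 0)).comp (jointL m k 0)).toLinearMap).domRestrict (distModel 1 q) with hf
    have hfa : ∀ w : distModel 1 q, f w = inner ℝ (bar q 0) (joint (w : Conf m k) 0) := fun w => by
      simp [hf, jointL_apply]
    have h1 := f.finrank_range_add_finrank_ker
    have h2 : LinearMap.range f = ⊤ := by
      obtain ⟨w, hw, hwe⟩ := exists_mem_distModel (m := m) hk hq (bar q 0)
      have h3 : f ⟨w, hw⟩ = 1 := by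
        rw [hfa, hw.2 0 one_pos, hwe, inner_bar_self hq hk, one_smul, inner_bar_self hq hk]
      rw [LinearMap.range_eq_top]
      exact fun c => ⟨c • ⟨w, hw⟩, by rw [map_smul, h3]; simp⟩
    have h4 : LinearMap.ker f = (verticalModel 0 q).comap (distModel 1 q).subtype := by
      ext ⟨w, hw⟩
      rw [LinearMap.mem_ker, hfa]
      refine ⟨fun h => distModel_one_inf_ker hk hq hw h, fun h => ?_⟩
      rw [show joint w 0 = 0 from h.2 0 le_rfl, inner_zero_right]
    rw [h2, finrank_top, Module.finrank_self, h4,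
      LinearEquiv.finrank_eq (Submodule.comapSubtypeEquivOfLe
        (verticalModel_le_distModel le_rfl q hk))] at h1
    omega
  smooth q hq v hv := by
    obtain ⟨Y, hY, hYq, hY1, hY2⟩ := exists_section_eq (Nat.zero_le k) hq
      (⟨hv.1, fun i hi => by omega⟩ : v ∈ distModel 0 q)
    exact ⟨_, Y, isLocalSection_univ hY fun y hy => mem_verticalModel_of_joint_eq_zero (hY2 y hy)
      (by rw [hY1, hv.2 0 le_rfl]), Set.mem_univ q, hYq⟩
  involutive U X V Y hX hY y hy := by
    refine ⟨lieBracket_mem_tangentModel (hX.mono fun _ _ => inf_le_left)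
      (hY.mono fun _ _ => inf_le_left) hy.1.1 hy.1.2 hy.2, fun i hi => ?_⟩
    have h0 : ∀ z ∈ configSpace m k, ∀ w ∈ verticalModel 0 z, joint w i = 0 :=
      fun z _ w hw => hw.2 i hi
    rw [VectorField.lieBracket, joint_sub,
      joint_fderiv_eq_zero hX hy.1.1 h0 hy.2 (hY.tangent y ⟨hy.1.2, hy.2⟩).1,
      joint_fderiv_eq_zero hY hy.1.2 h0 hy.2 (hX.tangent y ⟨hy.1.1, hy.2⟩).1, sub_zero]

/-- A subspace of codimension one meets every plane. -/
lemma exists_combination_mem {E : Type*} [AddCommGroup E] [Module ℝ E] [FiniteDimensional ℝ E]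
    {F D : Submodule ℝ E} (hF : F ≤ D) (hr : Module.finrank ℝ F + 1 = Module.finrank ℝ D)
    {a b : E} (ha : a ∈ D) (hb : b ∈ D) :
    ∃ s t : ℝ, (s ≠ 0 ∨ t ≠ 0) ∧ s • a + t • b ∈ F := by
  by_cases haF : a ∈ F
  · exact ⟨1, 0, Or.inl one_ne_zero, by simpa using haF⟩
  · have h1 : F < F ⊔ Submodule.span ℝ {a} := by
      refine lt_of_le_of_ne le_sup_left fun h => haF ?_
      rw [h]; exact Submodule.mem_sup_right (Submodule.mem_span_singleton_self a)
    have h2 : F ⊔ Submodule.span ℝ {a} ≤ D :=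
      sup_le hF (by simpa [Submodule.span_le] using ha)
    have h3 := Submodule.finrank_lt_finrank_of_lt h1
    have h4 : F ⊔ Submodule.span ℝ {a} = D :=
      Submodule.eq_of_le_of_finrank_le h2 (by omega)
    rw [← h4] at hb
    obtain ⟨f, hf, z, hz, rfl⟩ := Submodule.mem_sup.1 hb
    obtain ⟨c, rfl⟩ := Submodule.mem_span_singleton.1 hz
    exact ⟨-c, 1, Or.inr one_ne_zero, by convert hf using 1; module⟩

/-- Suppose that v in F moves x_0, i.e. ⟨v_1, u_0⟩ ≠ 0. Bracketing with a section through w in F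
with w_1 orthogonal to u_0 then forces w_1 to be parallel to u_0, hence zero. But since m ≥ 2 there
is a plane of vectors freezing x_0 with independent values of w_1 orthogonal to u_0, and a
hyperplane F of D_1 must meet it nontrivially. -/
lemma IsIntegrableCorankOne.le_verticalModel (hm : 2 ≤ m) (hk : 1 ≤ k)
    {F : Conf m k → Submodule ℝ (Conf m k)}
    (hF : IsIntegrableCorankOne (configSpace m k) (distModel 1) F) {q : Conf m k}
    (hq : q ∈ configSpace m k) : F q ≤ verticalModel 0 q := by
  intro v hv
  have hvD := hF.le q hq hv
  by_contra hv0
  set u := bar q 0 with hu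
  have huu : inner ℝ u u = (1 : ℝ) := inner_bar_self hq hk
  have hc : inner ℝ (joint v 1) u ≠ (0 : ℝ) := fun h => hv0 <| by
    refine distModel_one_inf_ker hk hq hvD ?_
    rw [hvD.2 0 one_pos, ← hu, zero_add, h, zero_smul, inner_zero_right]
  obtain ⟨U, X, hX, hU, hXq⟩ := hF.smooth q hq v hv
  have key : ∀ w ∈ F q, inner ℝ (joint w 1) u = (0 : ℝ) → joint w 1 = 0 := by
    intro w hw hwu
    obtain ⟨V, Y, hY, hV, hYq⟩ := hF.smooth q hq w hw
    have h1 := hF.le q hq (hF.involutive U X V Y hX hY q ⟨⟨hU, hV⟩, hq⟩)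
    obtain ⟨r, hr⟩ := joint_lieBracket (hX.mono hF.le) (hY.mono hF.le) hU hV hq one_pos
    have hw0 := (hF.le q hq hw).2 0 one_pos
    rw [zero_add, ← hu, hwu, zero_smul] at hw0
    rw [h1.2 0 one_pos, hXq, hYq, zero_add, ← hu, hwu, zero_smul, zero_sub, bar_eq w, zero_add, hw0,
      sub_zero] at hr
    set d := inner ℝ (joint (VectorField.lieBracket ℝ X Y q) 1) u with hd
    have h2 : inner ℝ (joint v 1) u • joint w 1 = (r - d) • u := by
      rw [sub_smul, hr]; abel
    have h3 : r - d = 0 := by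
      have := congrArg (fun z => inner ℝ z u) h2
      simp only [inner_smul_left, hwu, huu] at this
      simpa using this.symm
    rw [h3, zero_smul] at h2
    exact (smul_eq_zero.1 h2).resolve_left hc
  obtain ⟨e, f, he, hf, hef⟩ := exists_orthogonal_pair hm u
  obtain ⟨a, ha, hae⟩ := exists_distModel_of_orthogonal (m := m) hk hq he
  obtain ⟨b, hb, hbf⟩ := exists_distModel_of_orthogonal (m := m) hk hq hf
  rw [zero_add] at hae hbf
  obtain ⟨s, t, hst, hmem⟩ := exists_combination_mem (hF.le q hq) (hF.corank q hq)
    (verticalModel_le_distModel le_rfl q hk ha) (verticalModel_le_distModel le_rfl q hk hb)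
  have h1 : joint (s • a + t • b) 1 = s • e + t • f := by
    rw [joint_add, joint_smul, joint_smul, hae, hbf]
  have h2 := key _ hmem (by rw [h1, inner_add_left, inner_smul_left, inner_smul_left, he, hf]; simp)
  rw [h1] at h2
  obtain ⟨rfl, rfl⟩ := hef s t h2
  simp at hst

lemma integrableCorankOne_distModel (hm : 2 ≤ m) (hk : 1 ≤ k) {q : Conf m k}
    (hq : q ∈ configSpace m k) :
    integrableCorankOne (configSpace m k) (distModel 1) q = verticalModel 0 q :=
  le_antisymm (iSup₂_le fun _ hF => hF.le_verticalModel hm hk hq)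
    (le_iSup₂_of_le (verticalModel 0) (isIntegrableCorankOne_verticalModel hk) le_rfl)

lemma sandwichL_eq (hm : 2 ≤ m) {j : ℕ} (hk : 1 ≤ k) (hj : j ≤ k) {q : Conf m k}
    (hq : q ∈ configSpace m k) :
    sandwichL (configSpace m k) (armDist m k) k j q = verticalModel j q := by
  unfold sandwichL
  split_ifs with h
  · subst h
    rw [integrableCorankOne_congr (flag_eq hk), integrableCorankOne_distModel hm hk hq]
  · obtain ⟨j, rfl⟩ := Nat.exists_eq_succ_of_ne_zero h
    rw [cauchyCharacteristic_congr (flag_eq hj), Nat.succ_eq_add_one,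
      cauchyCharacteristic_distModel (by omega) hj hq]

/-- Inside D_{i+1}, the subspace L(D_i) is given by w_{i+1} ⊥ u_i, D_{i+2} by w_{i+1} ∥ u_{i+1}, and
L(D_{i+1}) by w_{i+1} = 0. The direct sum condition is thus complementarity of a hyperplane and a
line in ℝ^{m+1}. -/
lemma isCartanPoint_iff (hm : 2 ≤ m) {q : Conf m k} (hq : q ∈ configSpace m k) :
    IsCartanPoint (configSpace m k) (armDist m k) k q ↔
      ∀ i, i + 1 < k → inner ℝ (bar q (i + 1)) (bar q i) ≠ (0 : ℝ) := by
  have hiff : IsCartanPoint (configSpace m k) (armDist m k) k q ↔ ∀ i, i + 1 < k →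
      verticalModel i q ⊔ distModel (i + 2) q = distModel (i + 1) q ∧
      verticalModel i q ⊓ distModel (i + 2) q = verticalModel (i + 1) q := by
    constructor
    · intro h i hi
      have := h (i + 2) (by omega) (by omega)
      rwa [sandwichL_eq hm (by omega) (by omega) hq, sandwichL_eq hm (by omega) (by omega) hq,
        flag_eq (by omega) q hq, flag_eq (by omega) q hq] at this
    · intro h j h2 hj
      obtain ⟨i, rfl⟩ := Nat.exists_eq_add_of_le' h2
      rw [sandwichL_eq hm (by omega) (by omega) hq, sandwichL_eq hm (by omega) (by omega) hq,
        flag_eq (by omega) q hq, flag_eq (by omega) q hq]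
      exact h i (by omega)
  rw [hiff]
  refine forall₂_congr fun i hi => ?_
  constructor
  · rintro ⟨-, h⟩ h0
    obtain ⟨w, hw, hwe⟩ := exists_mem_distModel (m := m) (j := i + 1) (by omega) hq (bar q (i + 1))
    have h1 : w ∈ distModel (i + 2) q :=
      mem_distModel_succ hi hq hw (c := 1) (by rw [hwe, one_smul])
    have h2 : w ∈ verticalModel i q := mem_verticalModel_of_joint_eq_zero
      (distModel_anti (Nat.le_succ i) q hw) (by rw [hw.2 i (Nat.lt_succ_self i), hwe, h0, zero_smul])
    have h3 : w ∈ verticalModel (i + 1) q := h ▸ ⟨h2, h1⟩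
    exact bar_ne_zero hq hi (hwe ▸ h3.2 (i + 1) le_rfl)
  · intro h0
    refine ⟨le_antisymm (sup_le ?_ (distModel_anti (by omega) q)) fun w hw => ?_,
      le_antisymm ?_ (le_inf (verticalModel_anti (by omega) q) ?_)⟩
    · exact verticalModel_le_distModel le_rfl q (by omega)
    -- The multiple of u_{i+1} is the one with the same inner product with u_i as w_{i+1}: the
    -- oblique projection to ℝu_{i+1} along the hyperplane orthogonal to u_i.
    · obtain ⟨d, hd, hde⟩ := exists_mem_distModel (m := m) (j := i + 1) (by omega) hq
        ((inner ℝ (joint w (i + 1)) (bar q i) / inner ℝ (bar q (i + 1)) (bar q i)) • bar q (i + 1))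
      rw [← sub_add_cancel w d]
      refine Submodule.add_mem_sup (mem_verticalModel_of_joint_eq_zero
        (distModel_anti (Nat.le_succ i) q (sub_mem hw hd)) ?_) (mem_distModel_succ hi hq hd hde)
      rw [joint_sub, hw.2 i (Nat.lt_succ_self i), hd.2 i (Nat.lt_succ_self i), hde,
        inner_smul_left, RCLike.conj_to_real, div_mul_cancel₀ _ h0, sub_self]
    · rintro w ⟨hv, hd⟩
      refine mem_verticalModel_of_joint_eq_zero (distModel_anti (Nat.le_succ _) q hd) ?_
      obtain ⟨c, hc⟩ : ∃ c : ℝ, joint w (i + 1) = c • bar q (i + 1) := ⟨_, hd.2 (i + 1) (by omega)⟩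
      have h1 := hv.1 i (by omega)
      rw [bar, hv.2 i le_rfl, sub_zero, hc, inner_smul_left] at h1
      have : c = 0 := by simpa [h0] using h1
      rw [hc, this, zero_smul]
    · exact verticalModel_le_distModel le_rfl q (by omega)

end Flag

/-! ### Prolongations of the fibers -/

section Tower

variable {m k : ℕ}

lemma chainModel_le_tangentModel {q : Conf m k} (hq : q ∈ configSpace m k) :
    chainModel k q ≤ tangentModel q := by
  intro w hw i hi
  rw [bar_eq w, inner_sub_left, hw i hi, inner_smul_left, inner_bar_self hq hi]; simp

/-- Since w_{h+j} is parallel to u_{h+j}, which φ_j = 0 makes orthogonal to x_{h+j} - x_{h-1}, the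
terms combine into a pairing with x_{h+j+1} - x_{h-1}. This is how differentiating one equation
produces the next. -/
lemma tangencyDeriv_of_chain {h j : ℕ} {q w : Conf m k} (hφ : tangencyEq h j q = 0)
    (hj : h + j < k) (hq : q ∈ configSpace m k) (hw0 : joint w (h - 1) = 0)
    (hw : joint w (h + j) = inner ℝ (joint w (h + j + 1)) (bar q (h + j)) • bar q (h + j)) :
    tangencyDeriv h j q w = inner ℝ (joint w (h + (j + 1))) (reach h (j + 1) q) := by
  rw [tangencyEq_eq] at hφ
  rw [tangencyDeriv_apply, reach_succ, ← add_assoc]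
  have h1 : reach h j w = joint w (h + j) := by rw [reach, hw0, sub_zero]
  rw [h1, bar_eq w, hw, inner_sub_left, inner_smul_left, inner_smul_right, hφ,
    inner_bar_self hq hj, inner_add_right]
  simp; ring

/-- The explicit form of the distribution `𝔡^i_j` of the `j`-th prolongation of `S^i(p)`. -/
noncomputable def fiberPlane (i j : ℕ) (q : Conf m k) : Submodule ℝ (Conf m k) :=
  chainModel (i + j) q ⊓
    LinearMap.ker ((innerSL ℝ (reach i j q)).comp (jointL m k (i + j))).toLinearMap

lemma mem_fiberPlane {i j : ℕ} {q w : Conf m k} : w ∈ fiberPlane i j q ↔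
    w ∈ chainModel (i + j) q ∧ inner ℝ (joint w (i + j)) (reach i j q) = (0 : ℝ) := by
  rw [fiberPlane, Submodule.mem_inf, LinearMap.mem_ker]
  simp [jointL_apply, real_inner_comm]

lemma chainModel_anti {i j : ℕ} (h : i ≤ j) (q : Conf m k) : chainModel j q ≤ chainModel i q :=
  fun _ hw s hs => hw s (hs.trans_le h)

/-- It suffices that w_i is orthogonal to u_{i-1}: for j = 0 this is the equation of the plane; for
j > 0, w_i is parallel to u_i, which φ_0 = 0 makes orthogonal to u_{i-1}. -/
lemma fiberPlane_frozen {i j : ℕ} (hi : 1 ≤ i) {q w : Conf m k}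
    (hφ : ∀ s < j, tangencyEq i s q = 0) (hw : w ∈ fiberPlane i j q) :
    ∀ s ≤ i - 1, joint w s = 0 := by
  rw [mem_fiberPlane] at hw
  refine chain_eq_zero (chainModel_anti (by omega) q hw.1) ?_
  rw [hw.1 (i - 1) (by omega), Nat.sub_add_cancel hi, ← reach_zero hi]
  rcases Nat.eq_zero_or_pos j with rfl | hj
  · rw [show inner ℝ (joint w i) (reach i 0 q) = (0 : ℝ) from hw.2, zero_smul]
  · have := hφ 0 hj
    rw [tangencyEq_eq, add_zero] at this
    rw [hw.1 i (by omega), inner_smul_left, this, mul_zero, zero_smul]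

/-- The explicit form of the `j`-th prolongation of the fiber `S^i(p)`. -/
def towerSet (i j : ℕ) (p : Conf m (i - 1)) : Set (Conf m (i + j)) :=
  {q | q ∈ configSpace m (i + j) ∧ under (i - 1) q = p ∧ ∀ s < j, tangencyEq i s q = 0}

lemma mem_tangentSpace_towerSet {i j : ℕ} (hi : 1 ≤ i) {p : Conf m (i - 1)} {q w : Conf m (i + j)}
    (hq : q ∈ towerSet i j p) : w ∈ tangentSpace (towerSet i j p) q ↔
      w ∈ tangentModel q ∧ (∀ s ≤ i - 1, joint w s = 0) ∧ ∀ s < j, tangencyDeriv i s q w = 0 := by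
  constructor
  · refine fun hw => ⟨tangentSpace_le_tangentModel (fun y hy => hy.1) q hw, fun s hs => ?_,
      fun s hs => tangencyDeriv_eq_zero (fun y hy => hy.2.2 s hs) hw⟩
    have := hasFDerivAt_eq_zero_of_mem_tangentSpace hw
      ((hasFDerivAt_joint s q).sub_const (joint p s)) (Eventually.of_forall fun y hy => by
        rw [← hy.2.1, joint_under hs, sub_self])
    rwa [jointL_apply] at this
  · rintro ⟨hw, h0, hd⟩
    -- With n₀ = i - 1 and zero velocity there, the joints x_0, …, x_{i-1} stay exactly fixed, so
    -- the curve remains over p.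
    obtain ⟨γ, g0, g1, g2, g3⟩ := exists_curve hq.1 hw hi le_rfl hq.2.2 hd (n₀ := i - 1)
      (Nat.sub_le _ _) (fun s hs => by rw [bar_eq, h0 _ hs, h0 _ hs.le, sub_zero])
    refine Submodule.subset_span ⟨γ, g0, g1, g3.mono fun t ht => ⟨ht.1, ?_, ht.2⟩⟩
    rw [← hq.2.1]
    exact conf_ext fun s hs => by
      rw [joint_under hs, joint_under hs, g2 s hs, h0 s hs, smul_zero, add_zero]

lemma joint_addBar_of_le (p : Conf m k × Conf m k) {s : ℕ} (hs : s ≤ k) :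
    joint (addBar p) s = joint p.1 s := by
  rw [joint_of_le _ (Nat.le_succ_of_le hs), joint_of_le _ hs]
  simp [addBar, Fin.snoc, Nat.lt_succ_of_le hs]

lemma joint_addBar_succ (p : Conf m k × Conf m k) :
    joint (addBar p) (k + 1) = joint p.1 k + joint p.2 k := by
  rw [joint_of_le _ le_rfl, joint_last, joint_last]
  simp [addBar, Fin.snoc]

lemma bar_addBar_of_lt (p : Conf m k × Conf m k) {s : ℕ} (hs : s < k) :
    bar (addBar p) s = bar p.1 s := by
  rw [bar_eq, bar_eq, joint_addBar_of_le p hs.le, joint_addBar_of_le p hs]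

lemma bar_addBar_last (p : Conf m k × Conf m k) : bar (addBar p) k = joint p.2 k := by
  rw [bar_eq, joint_addBar_of_le p le_rfl, joint_addBar_succ, add_sub_cancel_left]

lemma under_addBar (p : Conf m k × Conf m k) : under k (addBar p) = p.1 :=
  conf_ext fun s hs => by rw [joint_under hs, joint_addBar_of_le p hs]

lemma tangencyEq_last {i j : ℕ} (q : Conf m (i + j + 1)) : tangencyEq i j q =
    inner ℝ (bar q (i + j)) (reach i j (under (i + j) q)) := by
  rw [tangencyEq_eq, reach, reach, joint_under le_rfl, joint_under (by omega)]

/-- A smooth inverse for `addBar`: a vector of the arm distribution is recovered from its last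
component, here the last bar, through the chain. -/
lemma exists_bundle_section (n : ℕ) : ∃ W : Conf m (n + 1) → Conf m n, ContDiff ℝ ∞ W ∧
    (∀ y, joint (W y) n = bar y n) ∧ ∀ y, W y ∈ chainModel n (under n y) := by
  obtain ⟨X, h1, h2, h3⟩ := exists_chain_fields (m := m) (k := n + 1) n (fun y => bar y n)
    (contDiff_bar n)
  refine ⟨fun y => ofSeq m n fun s => X s y, contDiff_pi.2 fun i => h1 i, fun y => ?_,
    fun y i hi => ?_⟩
  · rw [joint_ofSeq _ le_rfl, h2]
  · rw [joint_ofSeq _ hi.le, joint_ofSeq _ hi, bar_under hi, h3 i hi y]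

lemma contDiff_under {n : WithTop ℕ∞} (l : ℕ) : ContDiff ℝ n (under l : Conf m k → Conf m l) :=
  contDiff_pi.2 fun i => contDiff_joint (m := m) (k := k) i

/-! ### One prolongation step, with the explicit form of the j-th stage as hypothesis -/

section Step

variable {i j : ℕ} {p : Conf m (i - 1)} {A : DiffSystem m (i + j)}

lemma mem_sphereBundle (hA : A.carrier = towerSet i j p)
    (hplane : ∀ q ∈ towerSet i j p, A.plane q = fiberPlane i j q)
    {x : Conf m (i + j) × Conf m (i + j)} : x ∈ sphereBundle A ↔
      x.1 ∈ towerSet i j p ∧ x.2 ∈ fiberPlane i j x.1 ∧ ‖joint x.2 (i + j)‖ = 1 := by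
  rw [joint_last]
  constructor
  · rintro ⟨h1, h2, h3⟩
    rw [hA] at h1
    exact ⟨h1, hplane _ h1 ▸ h2, h3⟩
  · rintro ⟨h1, h2, h3⟩
    exact ⟨hA ▸ h1, (hplane _ h1).symm ▸ h2, h3⟩

lemma addBar_mem_towerSet (hA : A.carrier = towerSet i j p)
    (hplane : ∀ q ∈ towerSet i j p, A.plane q = fiberPlane i j q)
    {x : Conf m (i + j) × Conf m (i + j)} (hx : x ∈ sphereBundle A) :
    addBar x ∈ towerSet i (j + 1) p := by
  obtain ⟨h1, h2, h3⟩ := (mem_sphereBundle hA hplane).1 hx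
  refine ⟨fun s (hs : s < i + j + 1) => ?_, ?_, fun s hs => ?_⟩
  · change ‖bar (addBar x) s‖ = 1
    rcases Nat.lt_succ_iff_lt_or_eq.1 hs with hs | rfl
    · rw [bar_addBar_of_lt x hs, norm_bar h1.1 hs]
    · rw [bar_addBar_last, h3]
  · rw [← h1.2.1, ← under_under (l := i + j) (by omega), under_addBar]
  · rcases Nat.lt_succ_iff_lt_or_eq.1 hs with hs | rfl
    · rw [← tangencyEq_under (l := i + j) (by omega), under_addBar, h1.2.2 s hs]
    · rw [tangencyEq_last, under_addBar, bar_addBar_last]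
      exact (mem_fiberPlane.1 h2).2

lemma bundle_section_mem (hA : A.carrier = towerSet i j p)
    (hplane : ∀ q ∈ towerSet i j p, A.plane q = fiberPlane i j q)
    {y : Conf m (i + j + 1)} (hy : y ∈ towerSet i (j + 1) p) {w : Conf m (i + j)}
    (hw : joint w (i + j) = bar y (i + j)) (hwc : w ∈ chainModel (i + j) (under (i + j) y)) :
    (under (i + j) y, w) ∈ sphereBundle A := by
  refine (mem_sphereBundle hA hplane).2 ⟨⟨?_, ?_, fun s hs => ?_⟩, mem_fiberPlane.2 ⟨hwc, ?_⟩, ?_⟩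
  · exact under_mem (Nat.le_succ _) hy.1
  · rw [under_under (by omega)]; exact hy.2.1
  · rw [tangencyEq_under (by omega)]; exact hy.2.2 s (by omega)
  · rw [hw, ← tangencyEq_last]; exact hy.2.2 j (Nat.lt_succ_self j)
  · rw [hw]; exact norm_bar hy.1 (Nat.lt_succ_self _)

lemma addBar_bundle_section {n : ℕ} {y : Conf m (n + 1)} {w : Conf m n}
    (hw : joint w n = bar y n) : addBar (under n y, w) = y := by
  refine conf_ext fun s hs => ?_
  rcases Nat.le_succ_iff.1 hs with hs | rfl
  · rw [joint_addBar_of_le _ hs, joint_under hs]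
  · rw [Nat.succ_eq_add_one, joint_addBar_succ, hw, joint_under le_rfl, joint_succ]

lemma prolong_carrier (hA : A.carrier = towerSet i j p)
    (hplane : ∀ q ∈ towerSet i j p, A.plane q = fiberPlane i j q) :
    (prolong A).carrier = towerSet i (j + 1) p := by
  refine Set.Subset.antisymm ?_ fun y hy => ?_
  · rintro _ ⟨x, hx, rfl⟩
    exact addBar_mem_towerSet hA hplane hx
  · obtain ⟨W, -, h2, h3⟩ := exists_bundle_section (m := m) (i + j)
    exact ⟨_, bundle_section_mem hA hplane hy (h2 y) (h3 y), addBar_bundle_section (h2 y)⟩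

/-- The image under `addBar` of a prolonged vector is tangent to the next stage, so dφ_j vanishes on
it. Projection into ℝν makes it a chain vector up to the new joint, and for chain vectors dφ_j = 0
is the equation of the next plane. -/
lemma prolong_plane_le (hi : 1 ≤ i) (hA : A.carrier = towerSet i j p)
    (hplane : ∀ q ∈ towerSet i j p, A.plane q = fiberPlane i j q)
    {y : Conf m (i + j + 1)} (hy : y ∈ towerSet i (j + 1) p) :
    (prolong A).plane y ≤ fiberPlane i (j + 1) y := by
  refine iSup₂_le ?_
  rintro x ⟨hx, rfl⟩ _ ⟨⟨δ, ε⟩, ⟨hδ, hδw⟩, rfl⟩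
  obtain ⟨h1, h2, -⟩ := (mem_sphereBundle hA hplane).1 hx
  obtain ⟨c, hc⟩ := Submodule.mem_span_singleton.1 hδw
  replace hc : δ = c • x.2 := hc.symm
  have ht : addBar (δ, ε) ∈ tangentSpace (towerSet i (j + 1) p) (addBar x) :=
    map_tangentSpace_subset hδ (g := addBar) (g' := addBar.toContinuousLinearMap)
      (addBar.toContinuousLinearMap.hasFDerivAt) fun z hz => addBar_mem_towerSet hA hplane hz
  obtain ⟨k1, k2, k3⟩ := (mem_tangentSpace_towerSet hi hy).1 ht
  have hch : addBar (δ, ε) ∈ distModel (i + j + 1) (addBar x) := by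
    refine mem_distModel_succ (Nat.lt_succ_self _) hy.1 ⟨k1, fun s hs => ?_⟩ (c := c) ?_
    · rw [joint_addBar_of_le _ hs.le, joint_addBar_of_le _ hs, bar_addBar_of_lt _ hs, hc]
      exact Submodule.smul_mem _ c (mem_fiberPlane.1 h2).1 s hs
    · rw [joint_addBar_of_le _ le_rfl, bar_addBar_last, hc, joint_smul]
  refine mem_fiberPlane.2 ⟨hch.2, ?_⟩
  rw [← tangencyDeriv_of_chain (hy.2.2 j (Nat.lt_succ_self j)) (Nat.lt_succ_self (i + j)) hy.1
    (k2 _ le_rfl) (hch.2 _ (Nat.lt_succ_self _))]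
  exact k3 j (Nat.lt_succ_self j)

lemma fiberPlane_le_tangentSpace (hi : 1 ≤ i) {y : Conf m (i + j)} (hy : y ∈ towerSet i j p) :
    fiberPlane i j y ≤ tangentSpace (towerSet i j p) y := by
  intro w hw
  have h0 := fiberPlane_frozen hi hy.2.2 hw
  rw [mem_fiberPlane] at hw
  refine (mem_tangentSpace_towerSet hi hy).2
    ⟨chainModel_le_tangentModel hy.1 hw.1, h0, fun s hs => ?_⟩
  rw [tangencyDeriv_of_chain (hy.2.2 s hs) (by omega) hy.1 (h0 _ le_rfl) (hw.1 _ (by omega))]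
  -- The last dφ_s vanishes by the equation of the plane. For an earlier one, w_{i+s+1} is parallel
  -- to the bar there, and φ_{s+1} = 0 applies.
  rcases (Nat.succ_le_of_lt hs).eq_or_lt with rfl | hs'
  · exact hw.2
  · rw [hw.1 (i + (s + 1)) (by omega), inner_smul_left, ← tangencyEq_eq, hy.2.2 _ hs', mul_zero]

/-- The map σ sends the next stage into the sphere bundle and is a right inverse of `addBar`, so
dσ(η) is a tangent preimage of η. -/
lemma le_prolong_plane (hi : 1 ≤ i) (hA : A.carrier = towerSet i j p)
    (hplane : ∀ q ∈ towerSet i j p, A.plane q = fiberPlane i j q)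
    {y : Conf m (i + j + 1)} (hy : y ∈ towerSet i (j + 1) p) :
    fiberPlane i (j + 1) y ≤ (prolong A).plane y := by
  intro η hη
  obtain ⟨W, h1, h2, h3⟩ := exists_bundle_section (m := m) (i + j)
  set σ : Conf m (i + j + 1) → Conf m (i + j) × Conf m (i + j) := fun z => (under (i + j) z, W z)
    with hσ
  have hσd : HasFDerivAt σ (fderiv ℝ σ y) y :=
    (((contDiff_under (n := ∞) (i + j)).prodMk h1).differentiable (by simp) y).hasFDerivAt
  have hσS : ∀ z ∈ towerSet i (j + 1) p, σ z ∈ sphereBundle A := fun z hz =>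
    bundle_section_mem hA hplane hz (h2 z) (h3 z)
  have hid : addBar (fderiv ℝ σ y η) = η := by
    have e1 : HasFDerivAt (addBar ∘ σ) (addBar.toContinuousLinearMap.comp (fderiv ℝ σ y)) y :=
      (addBar.toContinuousLinearMap.hasFDerivAt).comp y hσd
    have e2 : addBar ∘ σ = id := funext fun z => addBar_bundle_section (h2 z)
    rw [e2] at e1
    exact DFunLike.congr_fun (e1.unique (hasFDerivAt_id y)) η
  have hmem : σ y ∈ {x | x ∈ sphereBundle A ∧ addBar x = y} :=
    ⟨hσS y hy, addBar_bundle_section (h2 y)⟩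
  refine Submodule.mem_iSup_of_mem (σ y) (Submodule.mem_iSup_of_mem hmem
    ⟨fderiv ℝ σ y η, ⟨?_, ?_⟩, hid⟩)
  · exact map_tangentSpace_subset (fiberPlane_le_tangentSpace hi hy hη) hσd hσS
  · rw [mem_fiberPlane] at hη
    have hM := under_mem (Nat.le_succ (i + j)) hy.1
    have hj : ∀ s ≤ i + j, joint (fderiv ℝ σ y η).1 s = joint η s := fun s hs => by
      rw [← joint_addBar_of_le _ hs, hid]
    obtain ⟨c, hc⟩ : ∃ c : ℝ, joint η (i + j) = c • bar y (i + j) := ⟨_, hη.1 _ (Nat.lt_succ_self _)⟩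
    have hch : (fderiv ℝ σ y η).1 ∈ chainModel (i + j) (under (i + j) y) := fun s hs => by
      rw [hj s hs.le, hj _ hs, bar_under hs]
      exact hη.1 s (by omega)
    -- The projection of dσ(η) and c times the direction W y both satisfy all the chain relations;
    -- equal last components make them equal.
    refine Submodule.mem_span_singleton.2 ⟨c, ?_⟩
    have hcW := Submodule.smul_mem _ c (h3 y)
    refine eq_of_mem_distModel ⟨chainModel_le_tangentModel hM hcW, hcW⟩
      ⟨chainModel_le_tangentModel hM hch, hch⟩ ?_ (fun s h h' => by omega)
    change joint (c • W y) (i + j) = joint (fderiv ℝ σ y η).1 (i + j)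
    rw [hj _ le_rfl, hc, joint_smul, h2]

end Step

lemma fiberTower_eq {i : ℕ} (hi : 1 ≤ i) (p : Conf m (i - 1)) (j : ℕ) :
    (fiberTower i p j).carrier = towerSet i j p ∧
      ∀ q ∈ towerSet i j p, (fiberTower i p j).plane q = fiberPlane i j q := by
  induction j with
  | zero =>
    have h0 : {q | q ∈ configSpace m i ∧ under (i - 1) q = p} = towerSet i 0 p := by
      ext q; simp [towerSet]
    refine ⟨h0, fun q hq => ?_⟩
    change tangentSpace {q | q ∈ configSpace m i ∧ under (i - 1) q = p} q = _
    rw [h0]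
    refine le_antisymm (fun w hw => ?_) (fiberPlane_le_tangentSpace hi hq)
    obtain ⟨k1, k2, -⟩ := (mem_tangentSpace_towerSet hi hq).1 hw
    have hv : w ∈ verticalModel (i - 1) q := ⟨k1, k2⟩
    refine mem_fiberPlane.2 ⟨(verticalModel_le_distModel (by omega) q le_rfl hv).2, ?_⟩
    have := k1 (i - 1) (by omega)
    rwa [bar_eq w, k2 _ le_rfl, sub_zero, Nat.sub_add_cancel hi, ← reach_zero hi] at this
  | succ j ih =>
    exact ⟨prolong_carrier ih.1 ih.2, fun q hq =>
      le_antisymm (prolong_plane_le hi ih.1 ih.2 hq) (le_prolong_plane hi ih.1 ih.2 hq)⟩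

/-- The equations with s < j express membership in the prolonged fiber, and the one with s = j that
z lies in its plane, since the last component of z is the bar u_{i+j}. -/
lemma liesInCritical_iff {i j : ℕ} (hi : 1 ≤ i) (hk : i + j + 1 ≤ k) {q : Conf m k}
    (hq : q ∈ configSpace m k) : LiesInCritical q i j ↔ ∀ s ≤ j, tangencyEq i s q = 0 := by
  obtain ⟨hc, hp⟩ := fiberTower_eq hi (under (i - 1) q) j
  have hM : under (i + j) q ∈ configSpace m (i + j) := under_mem (by omega) hq
  have hreach : reach i j (under (i + j) q) = reach i j q := by
    rw [reach, reach, joint_under le_rfl, joint_under (by omega)]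
  rw [LiesInCritical, hc]
  constructor
  · rintro ⟨hS, w, -, hw, hwp⟩ s hs
    rcases hs.lt_or_eq with hs | rfl
    · rw [← tangencyEq_under (l := i + j) (by omega)]; exact hS.2.2 s hs
    · rw [hp _ hS, mem_fiberPlane, hreach] at hwp
      have := bar_addBar_last (under (i + s) q, w)
      rw [hw, bar_under (Nat.lt_succ_self _)] at this
      rw [tangencyEq_eq, this]
      exact hwp.2
  · intro h
    have hS : under (i + j) q ∈ towerSet i j (under (i - 1) q) :=
      ⟨hM, under_under (by omega) q, fun s hs => by rw [tangencyEq_under (by omega), h s hs.le]⟩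
    obtain ⟨w, hw, hwe⟩ := exists_mem_distModel (m := m) le_rfl hM (bar q (i + j))
    refine ⟨hS, w, ⟨hM, (armDist_eq hM).ge hw, ?_⟩, ?_, ?_⟩
    · change ‖w (Fin.last _)‖ = 1
      rw [← joint_last w, hwe, norm_bar hq (by omega)]
    · rw [← under_under (l := i + j + 1) (Nat.le_succ _) q]
      refine addBar_bundle_section ?_
      rw [hwe, bar_under (Nat.lt_succ_self _)]
    · rw [hp _ hS, mem_fiberPlane, hwe, hreach]
      exact ⟨hw.2, h j le_rfl⟩

end Tower

/-! ### Codes -/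

section Codes

variable {m k : ℕ} {q : Conf m k}

lemma liesInCritical_under {i j l : ℕ} (hl : i + j + 1 ≤ l) (q : Conf m k) :
    LiesInCritical (under l q) i j ↔ LiesInCritical q i j := by
  simp only [LiesInCritical]
  rw [under_under (by omega : i + j ≤ l), under_under (by omega : i - 1 ≤ l), under_under hl]

lemma isVertical_under {n l : ℕ} (hn : n ≤ l) (q : Conf m k) :
    IsVertical (under l q) n ↔ IsVertical q n :=
  exists_congr fun _ => and_congr_right fun _ => and_congr_right fun h =>
    liesInCritical_under (by omega) q

lemma isCritical_under {n l : ℕ} (hn : n ≤ l) (q : Conf m k) :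
    IsCritical (under l q) n ↔ IsCritical q n :=
  exists₂_congr fun _ _ => and_congr_right fun _ => and_congr_right fun h =>
    liesInCritical_under (by omega) q

lemma IsVertical.isCritical {n : ℕ} (h : IsVertical q n) : IsCritical q n := by
  obtain ⟨i, h1, h2, h3⟩ := h
  exact ⟨i, 0, h1, h2, h3⟩

lemma isVertical_succ_iff {i : ℕ} (hi : 1 ≤ i) (hk : i + 1 ≤ k) (hq : q ∈ configSpace m k) :
    IsVertical q (i + 1) ↔ tangencyEq i 0 q = 0 := by
  constructor
  · rintro ⟨i', h1, h2, h3⟩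
    obtain rfl : i' = i := by omega
    exact (liesInCritical_iff h1 (by omega) hq).1 h3 0 le_rfl
  · intro h
    refine ⟨i, hi, rfl, (liesInCritical_iff hi (by omega) hq).2 fun s hs => ?_⟩
    obtain rfl : s = 0 := by omega
    exact h

lemma isCritical_iff {n : ℕ} (hk : n ≤ k) (hq : q ∈ configSpace m k) : IsCritical q n ↔
    ∃ i j, 1 ≤ i ∧ i + j + 1 = n ∧ ∀ s ≤ j, tangencyEq i s q = 0 :=
  exists₂_congr fun _ _ => and_congr_right fun h1 => and_congr_right fun h2 =>
    liesInCritical_iff h1 (by omega) hq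

/-- If q is critical for (i, j), the equation φ^i_0 = 0 makes q_{i+1} vertical, and shortening the
list of equations makes every q_n with i + 1 ≤ n ≤ k critical. Beyond the last vertical index, which
is at least i + 1, critical means tangency. -/
theorem exists_isGreatest_isVertical (hq : q ∈ configSpace m k) (ht : IsTangency q k) :
    ∃ l, IsGreatest {i | 2 ≤ i ∧ i ≤ k - 1 ∧ IsVertical q i} l ∧
      ∀ j, l < j → j ≤ k → IsTangency q j := by
  classical
  obtain ⟨i, j, hi, hij, hφ⟩ := (isCritical_iff le_rfl hq).1 ht.1
  have hv : IsVertical q (i + 1) :=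
    (isVertical_succ_iff hi (by omega) hq).2 (hφ 0 (Nat.zero_le j))
  have hj : 1 ≤ j := by
    rcases Nat.eq_zero_or_pos j with rfl | h
    · exact absurd (hij ▸ hv) ht.2
    · exact h
  have hmem : i + 1 ∈ {i | 2 ≤ i ∧ i ≤ k - 1 ∧ IsVertical q i} := ⟨by omega, by omega, hv⟩
  have hbdd : BddAbove {i | 2 ≤ i ∧ i ≤ k - 1 ∧ IsVertical q i} := ⟨k - 1, fun n hn => hn.2.1⟩
  refine ⟨_, ⟨Nat.sSup_mem ⟨_, hmem⟩ hbdd, fun n hn => le_csSup hbdd hn⟩, fun n hn hnk => ?_⟩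
  have h1 : i + 1 < n := (le_csSup hbdd hmem).trans_lt hn
  refine ⟨(isCritical_iff hnk hq).2 ⟨i, n - 1 - i, hi, by omega, fun s hs => hφ s (by omega)⟩, ?_⟩
  intro hvn
  rcases hnk.eq_or_lt with rfl | hnk
  · exact ht.2 hvn
  · exact absurd (le_csSup hbdd ⟨by omega, by omega, hvn⟩) (not_le.2 hn)

lemma letter_eq_R {n : ℕ} : letter q n = Letter.R ↔ ¬ IsCritical q n := by
  have := IsVertical.isCritical (q := q) (n := n)
  unfold letter IsTangency
  split_ifs with h1 h2 <;> simp_all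

lemma letter_eq_V {n : ℕ} : letter q n = Letter.V ↔ IsVertical q n := by
  unfold letter
  split_ifs with h1 h2 <;> simp_all

lemma letter_eq_T {n : ℕ} : letter q n = Letter.T ↔ IsTangency q n := by
  unfold letter
  split_ifs with h1 h2 <;> simp_all [IsTangency]

lemma rvtCode_eq_map_iff {f : ℕ → Letter} :
    rvtCode q = (List.range k).map f ↔ ∀ n < k, letter q (n + 1) = f n := by
  rw [rvtCode, List.map_inj_left]
  simp

lemma wordR_eq_map (h : ℕ) : wordR h = (List.range h).map fun _ => Letter.R := by
  simp [wordR]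

lemma wordRVT_eq_map (h l : ℕ) : wordRVT h l = (List.range (h + l + 1)).map fun n =>
    if n < h then Letter.R else if n = h then Letter.V else Letter.T := by
  refine List.ext_getElem (by simp [wordRVT, wordR]; omega) fun n h1 h2 => ?_
  simp only [wordRVT, wordR, List.getElem_map, List.getElem_range]
  rcases lt_trichotomy n h with h3 | rfl | h3
  · rw [List.getElem_append_left (by simpa using h3)]
    simp [h3]
  · rw [List.getElem_append_right (by simp)]
    simp
  · rw [List.getElem_append_right (by simpa using h3.le), List.getElem_cons]
    simp [Nat.sub_ne_zero_of_lt h3, h3.not_gt, h3.ne']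

/-- The configurations whose bars `s - 1` and `s` are not orthogonal, for `s ∈ I`. -/
def transverse (m k : ℕ) (I : Finset ℕ) : Set (Conf m k) := {q | ∀ s ∈ I, tangencyEq s 0 q ≠ 0}

lemma continuous_tangencyEq (h j : ℕ) : Continuous (fun q : Conf m k => tangencyEq h j q) :=
  (continuous_bar (h + j)).inner (contDiff_reach (n := 0) h j).continuous

lemma isOpen_transverse (I : Finset ℕ) : IsOpen (transverse m k I) := by
  have : transverse m k I = ⋂ s ∈ I, {q | tangencyEq s 0 q ≠ 0} := by
    ext q; simp [transverse]
  rw [this]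
  exact isOpen_biInter_finset fun s _ => isOpen_ne_fun (continuous_tangencyEq s 0) continuous_const

lemma mem_transverse_under {I : Finset ℕ} {l : ℕ} (hI : ∀ s ∈ I, s < l) :
    under l q ∈ transverse m l I ↔ q ∈ transverse m k I :=
  forall₂_congr fun s hs => by rw [tangencyEq_under (by simpa using hI s hs)]

/-- Every critical point contains an equation φ^i_0 = 0, hence a vertical point at or below it; so
regularity up to h only requires the absence of vertical points. -/
lemma mem_rvtClass_wordR {h : ℕ} (hh : h ≤ k) : q ∈ rvtClass m k h (wordR h) ↔
    q ∈ configSpace m k ∧ q ∈ transverse m k (Finset.Ico 1 h) := by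
  refine and_congr_right fun hq => ?_
  rw [wordR_eq_map, rvtCode_eq_map_iff]
  simp only [letter_eq_R]
  constructor
  · intro H s hs h0
    rw [Finset.mem_Ico] at hs
    exact H s hs.2 ((isCritical_under (by omega) q).2
      ((isVertical_succ_iff hs.1 (by omega) hq).2 h0).isCritical)
  · intro H n hn hc
    rw [isCritical_under (by omega), isCritical_iff (by omega) hq] at hc
    obtain ⟨i, j, hi, hij, hφ⟩ := hc
    exact H i (Finset.mem_Ico.2 ⟨hi, by omega⟩) (hφ 0 (Nat.zero_le j))

lemma mem_rvtClass_wordRVT {h l : ℕ} (hh : 1 ≤ h) (hk : h + l + 1 ≤ k) :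
    q ∈ rvtClass m k (h + l + 1) (wordRVT h l) ↔ q ∈ configSpace m k ∧
      q ∈ transverse m k ((Finset.Icc 1 (h + l)).erase h) ∧ ∀ j ≤ l, tangencyEq h j q = 0 := by
  refine and_congr_right fun hq => ?_
  rw [wordRVT_eq_map, rvtCode_eq_map_iff]
  constructor
  · intro H
    have hV : IsVertical q (h + 1) := by
      have := H h (by omega)
      simp only [lt_irrefl, if_true, if_false] at this
      exact (isVertical_under (by omega) q).1 (letter_eq_V.1 this)
    have hT : ∀ n, h < n → n ≤ h + l → IsCritical q (n + 1) ∧ ¬ IsVertical q (n + 1) := by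
      intro n h1 h2
      have := H n (by omega)
      simp only [h1.not_gt, h1.ne', if_false, letter_eq_T, IsTangency] at this
      rwa [isVertical_under (by omega), isCritical_under (by omega)] at this
    have hR : ∀ n < h, ¬ IsCritical q (n + 1) := by
      intro n h1
      have := H n (by omega)
      simp only [h1, if_true, letter_eq_R] at this
      rwa [isCritical_under (by omega)] at this
    have htr : q ∈ transverse m k ((Finset.Icc 1 (h + l)).erase h) := by
      intro s hs h0
      rw [Finset.mem_erase, Finset.mem_Icc] at hs
      have hv := (isVertical_succ_iff hs.2.1 (by omega) hq).2 h0
      rcases Nat.lt_or_gt_of_ne hs.1 with h1 | h1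
      · exact hR s h1 hv.isCritical
      · exact (hT s h1 hs.2.2).2 hv
    refine ⟨htr, fun j hj => ?_⟩
    rcases Nat.eq_zero_or_pos j with rfl | hj0
    · exact (isVertical_succ_iff hh (by omega) hq).1 hV
    · obtain ⟨i, s, hi, his, hφ⟩ :=
        (isCritical_iff (by omega) hq).1 (hT (h + j) (by omega) (by omega)).1
      -- A tower making q_{h+j+1} critical starts at an i for which q_{i+1} is vertical, and q_{h+1}
      -- is the only vertical point of the code.
      have hih : i = h := by
        by_contra hne
        exact htr i (Finset.mem_erase.2 ⟨hne, Finset.mem_Icc.2 ⟨hi, by omega⟩⟩)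
          (hφ 0 (Nat.zero_le s))
      subst hih
      exact hφ j (by omega)
  · rintro ⟨htr, hφ⟩ n hn
    have hnv : ∀ s, 1 ≤ s → s ≤ h + l → s ≠ h → tangencyEq s 0 q ≠ 0 := fun s h1 h2 h3 =>
      htr s (Finset.mem_erase.2 ⟨h3, Finset.mem_Icc.2 ⟨h1, h2⟩⟩)
    rcases lt_trichotomy n h with h3 | rfl | h3
    · rw [if_pos h3, letter_eq_R, isCritical_under (by omega), isCritical_iff (by omega) hq]
      rintro ⟨i, j, hi, hij, hφ'⟩
      exact hnv i hi (by omega) (by omega) (hφ' 0 (Nat.zero_le j))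
    · rw [if_neg (lt_irrefl n), if_pos rfl, letter_eq_V, isVertical_under (by omega),
        isVertical_succ_iff hh (by omega) hq]
      exact hφ 0 (Nat.zero_le l)
    · rw [if_neg h3.not_gt, if_neg h3.ne', letter_eq_T, IsTangency, isVertical_under (by omega),
        isCritical_under (by omega), isVertical_succ_iff (by omega) (by omega) hq,
        isCritical_iff (by omega) hq]
      exact ⟨⟨h, n - h, hh, by omega, fun s hs => hφ s (by omega)⟩,
        hnv n (by omega) (by omega) h3.ne'⟩

lemma mem_cartanSet (hm : 2 ≤ m) :
    q ∈ cartanSet m k ↔ q ∈ configSpace m k ∧ q ∈ transverse m k (Finset.Ico 1 k) := by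
  refine and_congr_right fun hq => ?_
  rw [isCartanPoint_iff hm hq]
  constructor
  · intro H s hs
    rw [Finset.mem_Ico] at hs
    obtain ⟨i, rfl⟩ := Nat.exists_eq_add_of_le' hs.1
    rw [tangencyEq_eq, reach_zero hs.1]
    exact H i hs.2
  · intro H i hi
    have := H (i + 1) (Finset.mem_Ico.2 ⟨by omega, hi⟩)
    rwa [tangencyEq_eq, reach_zero (by omega)] at this

lemma mem_rvtClass_wordR_iff_cartan (hm : 2 ≤ m) {h : ℕ} (hh : h ≤ k) :
    q ∈ rvtClass m k h (wordR h) ↔ q ∈ configSpace m k ∧ under h q ∈ cartanSet m h := by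
  rw [mem_rvtClass_wordR hh, mem_cartanSet hm,
    mem_transverse_under (fun s hs => (Finset.mem_Ico.1 hs).2)]
  exact ⟨fun H => ⟨H.1, under_mem hh H.1, H.2⟩, fun H => ⟨H.1, H.2.2⟩⟩

lemma mem_transverse_split {h l : ℕ} (hh : 1 ≤ h) (hk : h + l + 1 ≤ k)
    (hq : q ∈ configSpace m k) :
    q ∈ transverse m k ((Finset.Icc 1 (h + l)).erase h) ↔
      q ∈ transverse m k (Finset.Ico 1 h) ∧
        ∀ i, 1 ≤ i → i ≤ l → ¬ IsVertical q (h + i + 1) := by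
  constructor
  · intro H
    refine ⟨fun s hs => ?_, fun i h1 h2 => ?_⟩
    · rw [Finset.mem_Ico] at hs
      exact H s (Finset.mem_erase.2 ⟨by omega, Finset.mem_Icc.2 ⟨hs.1, by omega⟩⟩)
    · rw [isVertical_succ_iff (by omega) (by omega) hq]
      exact H _ (Finset.mem_erase.2 ⟨by omega, Finset.mem_Icc.2 ⟨by omega, by omega⟩⟩)
  · rintro ⟨H1, H2⟩ s hs
    rw [Finset.mem_erase, Finset.mem_Icc] at hs
    rcases Nat.lt_or_gt_of_ne hs.1 with h1 | h1
    · exact H1 s (Finset.mem_Ico.2 ⟨hs.2.1, h1⟩)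
    · obtain ⟨i, rfl⟩ := Nat.exists_eq_add_of_lt h1
      have := H2 (i + 1) (by omega) (by omega)
      rwa [← add_assoc, isVertical_succ_iff (by omega) (by omega) hq] at this

lemma rvtClass_wordRVT_eq {h l : ℕ} (hh : 1 ≤ h) (hk : h + l + 1 ≤ k) :
    rvtClass m k (h + l + 1) (wordRVT h l) = {q | q ∈ rvtClass m k h (wordR h) ∧
      (∀ i, 1 ≤ i → i ≤ l → ¬ IsVertical q (h + i + 1)) ∧ ∀ j ≤ l, tangencyEq h j q = 0} := by
  ext q
  rw [mem_rvtClass_wordRVT hh hk, Set.mem_ofPred_eq, mem_rvtClass_wordR (by omega), and_assoc]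
  refine and_congr_right fun hq => ?_
  rw [mem_transverse_split hh hk hq, and_assoc]

/-! ### The differentials of the equations -/

lemma surjective_of_triangular {W : Type*} [AddCommGroup W] [Module ℝ W] {n : ℕ}
    (f : W →ₗ[ℝ] Fin n → ℝ) (hf : ∀ j, ∃ w, (∀ i < j, f w i = 0) ∧ f w j ≠ 0) :
    Function.Surjective f := by
  intro c
  have : ∀ s ≤ n, ∃ w, ∀ i : Fin n, (i : ℕ) < s → f w i = c i := by
    intro s
    induction s with
    | zero => exact fun _ => ⟨0, fun i hi => by omega⟩
    | succ s ih =>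
      intro hs
      obtain ⟨w, hw⟩ := ih (by omega)
      obtain ⟨v, hv, hvs⟩ := hf ⟨s, hs⟩
      refine ⟨w + ((c ⟨s, hs⟩ - f w ⟨s, hs⟩) / f v ⟨s, hs⟩) • v, fun i hi => ?_⟩
      rw [map_add, map_smul, Pi.add_apply, Pi.smul_apply, smul_eq_mul]
      rcases Nat.lt_succ_iff_lt_or_eq.1 hi with hi | hi
      · rw [hw i hi, hv i hi]; simp
      · obtain rfl : i = ⟨s, hs⟩ := Fin.ext hi
        rw [div_mul_cancel₀ _ hvs]; ring
  obtain ⟨w, hw⟩ := this n le_rfl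
  exact ⟨w, funext fun i => hw i i.2⟩

/-- The map `(φ_0, …, φ_l)`. -/
noncomputable def tangencyMap (m k h l : ℕ) (q : Conf m k) : Fin (l + 1) → ℝ :=
  fun j => tangencyEq h j q

lemma contDiff_tangencyMap {n : WithTop ℕ∞} (h l : ℕ) : ContDiff ℝ n (tangencyMap m k h l) :=
  contDiff_pi.2 fun j => (contDiff_bar (h + j)).inner ℝ (contDiff_reach h j)

lemma hasFDerivAt_tangencyMap (h l : ℕ) (q : Conf m k) : HasFDerivAt (tangencyMap m k h l)
    (ContinuousLinearMap.pi fun j : Fin (l + 1) => tangencyDeriv h j q) q :=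
  hasFDerivAt_pi.2 fun j => hasFDerivAt_tangencyEq h j q

lemma surjective_fderiv_tangencyMap {h l : ℕ} (hh : 1 ≤ h) (hk : h + l + 1 ≤ k)
    (hq : q ∈ configSpace m k) (hφ : ∀ j ≤ l, tangencyEq h j q = 0) :
    Function.Surjective ((fderiv ℝ (tangencyMap m k h l) q).toLinearMap.domRestrict
      (tangentSpace (configSpace m k) q)) := by
  rw [(hasFDerivAt_tangencyMap h l q).fderiv, tangentSpace_configSpace hq]
  refine surjective_of_triangular _ fun j => ?_
  have hjl : (j : ℕ) ≤ l := Nat.le_of_lt_succ j.2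
  set b := reach h j q with hb
  -- Fix the joints up to h + j and translate all the later ones along x_{h+j} - x_{h-1}. The
  -- equation φ_j = 0 says precisely that this preserves the length of bar h + j to first order. The
  -- earlier φ_i do not see it, and dφ_j(w) = |x_{h+j} - x_{h-1}|² ≠ 0.
  let w : Conf m k := ofSeq m k fun s => if s ≤ h + j then 0 else b
  have hw0 : ∀ s ≤ h + j, joint w s = 0 := fun s hs => by
    simp only [w]; rw [joint_ofSeq _ (by omega), if_pos hs]
  have hw1 : ∀ s, h + j < s → s ≤ k → joint w s = b := fun s hs hsk => by
    simp only [w]; rw [joint_ofSeq _ hsk, if_neg (by omega)]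
  have hφj := hφ j hjl
  rw [tangencyEq_eq, ← hb] at hφj
  have hwt : w ∈ tangentModel q := by
    intro s hs
    rw [bar_eq w]
    rcases lt_trichotomy s (h + j) with h1 | rfl | h1
    · rw [hw0 _ h1, hw0 _ h1.le, sub_zero, inner_zero_left]
    · rw [hw0 _ le_rfl, hw1 _ (by omega) hs, sub_zero, real_inner_comm, hφj]
    · rw [hw1 _ (by omega) hs, hw1 _ h1 hs.le, sub_self, inner_zero_left]
  refine ⟨⟨w, hwt⟩, fun i hi => ?_, ?_⟩
  · have hi' : (i : ℕ) < j := hi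
    change tangencyDeriv h i q w = 0
    rw [tangencyDeriv_apply, reach, bar_eq w, hw0 _ (by omega), hw0 _ (by omega),
      hw0 _ (by omega)]
    simp
  · change tangencyDeriv h j q w ≠ 0
    rw [tangencyDeriv_apply, reach, bar_eq w, hw0 _ (by omega), hw0 _ (by omega),
      hw1 _ (by omega) (by omega), ← hb, sub_zero, sub_zero, inner_zero_right, zero_add,
      real_inner_self_eq_norm_sq]
    exact pow_ne_zero 2 (norm_ne_zero_iff.2
      (reach_ne_zero hh (by omega : h + l ≤ k) hq (fun s hs => hφ s hs.le) hjl))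

lemma linearIndependent_fderiv_tangencyEq {h l : ℕ} (hh : 1 ≤ h) (hk : h + l + 1 ≤ k)
    (hq : q ∈ configSpace m k) (hφ : ∀ j ≤ l, tangencyEq h j q = 0) :
    LinearIndependent ℝ (fun j : Fin (l + 1) =>
      (fderiv ℝ (fun y : Conf m k => tangencyEq h j y) q).toLinearMap.domRestrict
        (tangentSpace (configSpace m k) q)) := by
  rw [Fintype.linearIndependent_iff]
  intro g hg i
  obtain ⟨w, hw⟩ := surjective_fderiv_tangencyMap hh hk hq hφ (Pi.single i 1)
  rw [(hasFDerivAt_tangencyMap h l q).fderiv] at hw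
  have h1 := LinearMap.congr_fun hg w
  have h2 : ∀ j : Fin (l + 1), tangencyDeriv h j q (w : Conf m k) =
      Pi.single (M := fun _ => ℝ) i 1 j :=
    fun j => congrFun hw j
  simpa [(hasFDerivAt_tangencyEq h _ q).fderiv, h2, Pi.single_apply] using h1

lemma isAnalyticSubmanifold_rvtClass {h l : ℕ} (hh : 1 ≤ h) (hk : h + l + 1 ≤ k) :
    IsAnalyticSubmanifold (configSpace m k) (rvtClass m k (h + l + 1) (wordRVT h l)) (l + 1) := by
  refine ⟨fun q hq => hq.1, fun q hq => ?_⟩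
  rw [mem_rvtClass_wordRVT hh hk] at hq
  refine ⟨_, tangencyMap m k h l, isOpen_transverse _, hq.2.1,
    (contDiff_omega_iff_analyticOnNhd.1 (contDiff_tangencyMap h l)).mono (Set.subset_univ _), ?_,
    surjective_fderiv_tangencyMap hh hk hq.1 hq.2.2⟩
  ext y
  rw [Set.mem_inter_iff, mem_rvtClass_wordRVT hh hk]
  have : tangencyMap m k h l y = 0 ↔ ∀ j ≤ l, tangencyEq h j y = 0 :=
    ⟨fun H j hj => congrFun H ⟨j, Nat.lt_succ_of_le hj⟩,
      fun H => funext fun j => H j (Nat.le_of_lt_succ j.2)⟩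
  rw [Set.mem_ofPred_eq, this]
  tauto

/-! ### The projection onto the Cartan points -/

lemma exists_extension {n : ℕ} {q : Conf m n} (hq : q ∈ configSpace m n)
    {v : EuclideanSpace ℝ (Fin (m + 1))} (hv : ‖v‖ = 1) :
    ∃ y ∈ configSpace m (n + 1), under n y = q ∧ bar y n = v := by
  have hb : bar (addBar (q, ofSeq m n fun _ => v)) n = v := by
    rw [bar_addBar_last, joint_ofSeq _ le_rfl]
  refine ⟨addBar (q, ofSeq m n fun _ => v), fun s hs => ?_, under_addBar _, hb⟩
  change ‖bar (addBar (q, ofSeq m n fun _ => v)) s‖ = 1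
  rcases Nat.lt_succ_iff_lt_or_eq.1 hs with hs | rfl
  · rw [bar_addBar_of_lt _ hs, norm_bar hq hs]
  · rw [hb, hv]

lemma reach_under {h j l : ℕ} (hl : h + j ≤ l) (q : Conf m k) :
    reach h j (under l q) = reach h j q := by
  rw [reach, reach, joint_under hl, joint_under (by omega)]

/-- The arm is extended one bar at a time: the first new bar is orthogonal to the last bar of p, and
each later one is orthogonal to x_{h+l+1} - x_{h-1} but not to the bar before it. -/
lemma exists_rvtClass_over (hm : 2 ≤ m) {h : ℕ} (hh : 1 ≤ h) {p : Conf m h}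
    (hp : p ∈ cartanSet m h) (l : ℕ) :
    ∃ q ∈ rvtClass m (h + l + 1) (h + l + 1) (wordRVT h l), under h q = p := by
  rw [mem_cartanSet hm] at hp
  induction l with
  | zero =>
    obtain ⟨v, hv, hvu⟩ := exists_unit_orthogonal (m := m) (by omega) (bar p (h - 1))
    obtain ⟨y, hy, hyp, hyv⟩ := exists_extension hp.1 hv
    refine ⟨y, (mem_rvtClass_wordRVT (l := 0) hh le_rfl).2 ⟨hy, ?_, fun j hj => ?_⟩, hyp⟩
    · have : (Finset.Icc 1 (h + 0)).erase h = Finset.Ico 1 h := by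
        ext s; simp only [Finset.mem_erase, Finset.mem_Icc, Finset.mem_Ico]; omega
      rw [this, ← mem_transverse_under (l := h) (fun s hs => (Finset.mem_Ico.1 hs).2)]
      exact hyp.symm ▸ hp.2
    · obtain rfl : j = 0 := by omega
      rw [tangencyEq_eq, ← reach_under (l := h) le_rfl, hyp, reach_zero hh]
      exact hyv.symm ▸ hvu
  | succ l ih =>
    obtain ⟨q, hq, hqp⟩ := ih
    rw [mem_rvtClass_wordRVT hh le_rfl] at hq
    obtain ⟨hqM, hqt, hqφ⟩ := hq
    set u := bar q (h + l) with hu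
    set b := reach h l q with hb
    have huu : inner ℝ u u = (1 : ℝ) := inner_bar_self hqM (by omega)
    have hub : inner ℝ u b = (0 : ℝ) := hqφ l le_rfl
    have hbu : inner ℝ b u = (0 : ℝ) := by rw [real_inner_comm, hub]
    have hbb : inner ℝ b b = ((l : ℝ) + 1) :=
      inner_reach_self hh (by omega : h + l ≤ h + l + 1) hqM (fun s hs => hqφ s hs.le) l le_rfl
    have hl : ((l : ℝ) + 1) ≠ 0 := by positivity
    -- Here u and b are orthogonal, with |u|² = 1 and |b|² = l + 1. In their plane this v is
    -- orthogonal to b + u and has inner product l + 1 ≠ 0 with u.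
    set v := ((l : ℝ) + 1) • u - b with hv
    have hvu : inner ℝ v u = ((l : ℝ) + 1) := by
      rw [hv, inner_sub_left, inner_smul_left, huu, hbu]; simp
    have hvb : inner ℝ v (b + u) = (0 : ℝ) := by
      rw [inner_add_right, hvu, hv, inner_sub_left, inner_smul_left, hub, hbb]; simp
    have hv0 : v ≠ 0 := by
      intro h0; rw [h0, inner_zero_left] at hvu; exact hl hvu.symm
    have hvn : ‖v‖ ≠ 0 := norm_ne_zero_iff.2 hv0
    obtain ⟨y, hy, hyq, hyv⟩ := exists_extension hqM (v := ‖v‖⁻¹ • v)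
      (by rw [norm_smul, norm_inv, norm_norm, inv_mul_cancel₀ hvn])
    refine ⟨y, (mem_rvtClass_wordRVT hh le_rfl).2 ⟨hy, fun s hs => ?_, fun j hj => ?_⟩, ?_⟩
    · rw [Finset.mem_erase, Finset.mem_Icc] at hs
      rcases Nat.lt_or_ge s (h + l + 1) with h1 | h1
      · rw [← tangencyEq_under (l := h + l + 1) h1, hyq]
        exact hqt s (Finset.mem_erase.2 ⟨hs.1, Finset.mem_Icc.2 ⟨hs.2.1, by omega⟩⟩)
      · obtain rfl : s = h + l + 1 := by omega
        rw [tangencyEq_eq, reach_zero hs.2.1]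
        change inner ℝ (bar y (h + l + 1)) (bar y (h + l)) ≠ 0
        rw [hyv, ← bar_under (l := h + l + 1) (Nat.lt_succ_self _), hyq, inner_smul_left, ← hu, hvu]
        simpa using ⟨hv0, hl⟩
    · rcases Nat.lt_or_ge j (l + 1) with h1 | h1
      · rw [← tangencyEq_under (l := h + l + 1) (by omega), hyq]
        exact hqφ j (by omega)
      · obtain rfl : j = l + 1 := by omega
        rw [tangencyEq_eq, ← reach_under (h := h) (j := l + 1) (l := h + l + 1) le_rfl, hyq,
          reach_succ, ← hu, ← hb]
        change inner ℝ (bar y (h + l + 1)) (b + u) = 0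
        rw [hyv, inner_smul_left, hvb, mul_zero]
    · rw [← hqp, ← hyq, under_under (by omega)]

/-! ### The tangent space of the classes -/

lemma mem_tangentSpace_rvtClass {h l : ℕ} (hh : 1 ≤ h) (hk : h + l + 1 ≤ k)
    (hq : q ∈ rvtClass m k (h + l + 1) (wordRVT h l)) {w : Conf m k} :
    w ∈ tangentSpace (rvtClass m k (h + l + 1) (wordRVT h l)) q ↔
      w ∈ tangentModel q ∧ ∀ j ≤ l, tangencyDeriv h j q w = 0 := by
  have hS : ∀ {y}, y ∈ rvtClass m k (h + l + 1) (wordRVT h l) ↔ _ :=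
    fun {y} => mem_rvtClass_wordRVT (q := y) hh hk
  constructor
  · exact fun hw => ⟨tangentSpace_le_tangentModel (fun y hy => hy.1) q hw, fun j hj =>
      tangencyDeriv_eq_zero (fun y hy => (hS.1 hy).2.2 j hj) hw⟩
  · rintro ⟨hw, hd⟩
    obtain ⟨hqM, hqt, hqφ⟩ := hS.1 hq
    obtain ⟨γ, g0, g1, -, g3⟩ := exists_curve hqM hw hh (J := l + 1) hk
      (fun j hj => hqφ j (by omega)) (fun j hj => hd j (by omega)) (n₀ := 0) (by omega)
      (fun s hs => by omega)
    -- The non-orthogonality conditions are open, so they impose nothing on the tangent space.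
    have hev : ∀ᶠ t in 𝓝 (0 : ℝ), γ t ∈ transverse m k ((Finset.Icc 1 (h + l)).erase h) :=
      g1.continuousAt.eventually_mem ((isOpen_transverse _).mem_nhds (by rwa [g0]))
    refine Submodule.subset_span ⟨γ, g0, g1, ?_⟩
    filter_upwards [g3, hev] with t ht ht'
    exact hS.2 ⟨ht.1, ht', fun j hj => ht.2 j (by omega)⟩

lemma joint_eq_zero_of_tangencyEq {h n : ℕ} (hh : 1 ≤ h) (hn : h < n) {w : Conf m k}
    (hφ : tangencyEq h 0 q = 0) (hw : w ∈ chainModel n q) : joint w (h - 1) = 0 := by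
  rw [tangencyEq_eq, reach_zero hh, add_zero] at hφ
  rw [hw (h - 1) (by omega), Nat.sub_add_cancel hh, hw h hn, inner_smul_left, hφ, mul_zero,
    zero_smul]

/-- On D_{h+l+2} each dφ_j is the pairing of w_{h+j+1} with x_{h+j+1} - x_{h-1}, where w_{h+j+1} is
parallel to its bar. For j < l this vanishes by φ_{j+1} = 0; for j = l, taking w_{h+l+1} to be the
bar itself gives φ_{l+1}. -/
lemma distModel_le_tangentSpace_rvtClass {h l : ℕ} (hh : 1 ≤ h) (hk : h + l + 2 ≤ k)
    (hq : q ∈ rvtClass m k (h + l + 1) (wordRVT h l)) :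
    distModel (h + l + 2) q ≤ tangentSpace (rvtClass m k (h + l + 1) (wordRVT h l)) q ↔
      tangencyEq h (l + 1) q = 0 := by
  obtain ⟨hqM, hqt, hqφ⟩ := (mem_rvtClass_wordRVT hh (by omega)).1 hq
  have key : ∀ w ∈ distModel (h + l + 2) q, ∀ j ≤ l, tangencyDeriv h j q w =
      inner ℝ (joint w (h + (j + 1))) (reach h (j + 1) q) := fun w hw j hj =>
    tangencyDeriv_of_chain (hqφ j hj) (by omega) hqM
      (joint_eq_zero_of_tangencyEq hh (by omega) (hqφ 0 (Nat.zero_le l)) hw.2)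
      (hw.2 _ (by omega))
  constructor
  · intro H
    obtain ⟨w, hw, hwe⟩ := exists_mem_distModel (m := m) (j := h + l + 1) (by omega) hqM
      (bar q (h + l + 1))
    have hw' : w ∈ distModel (h + l + 2) q :=
      mem_distModel_succ (by omega) hqM hw (c := 1) (by rw [hwe, one_smul])
    have := ((mem_tangentSpace_rvtClass hh (by omega) hq).1 (H hw')).2 l le_rfl
    rw [key w hw' l le_rfl] at this
    rw [tangencyEq_eq]
    change joint w (h + (l + 1)) = bar q (h + (l + 1)) at hwe
    rwa [hwe] at this
  · intro H w hw
    refine (mem_tangentSpace_rvtClass hh (by omega) hq).2 ⟨hw.1, fun j hj => ?_⟩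
    have hφ : tangencyEq h (j + 1) q = 0 := by
      rcases hj.lt_or_eq with hj | rfl
      · exact hqφ _ hj
      · exact H
    rw [key w hw j hj, hw.2 (h + (j + 1)) (by omega), inner_smul_left, ← tangencyEq_eq, hφ,
      mul_zero]

/-- On D_{h+1} the component w_h runs over ℝu_h, and w_{h-1} = ⟨w_h, u_{h-1}⟩ u_{h-1} vanishes
throughout exactly when the two bars are orthogonal. -/
lemma distModel_le_verticalModel_iff {h : ℕ} (hh : 1 ≤ h) (hk : h + 1 ≤ k)
    (hq : q ∈ configSpace m k) :
    distModel (h + 1) q ≤ verticalModel (h - 1) q ↔ tangencyEq h 0 q = 0 := by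
  constructor
  · intro H
    obtain ⟨w, hw, hwe⟩ := exists_mem_distModel (m := m) (j := h) (by omega) hq (bar q h)
    have hw' : w ∈ distModel (h + 1) q :=
      mem_distModel_succ hk hq hw (c := 1) (by rw [hwe, one_smul])
    have h1 := (H hw').2 (h - 1) le_rfl
    rw [hw.2 (h - 1) (by omega), Nat.sub_add_cancel hh, hwe] at h1
    rw [tangencyEq_eq, reach_zero hh]
    exact (smul_eq_zero.1 h1).resolve_right (bar_ne_zero hq (by omega))
  · exact fun H w hw => mem_verticalModel_of_joint_eq_zero (distModel_anti (by omega) q hw)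
      (joint_eq_zero_of_tangencyEq hh (Nat.lt_succ_self h) H hw.2)

/-! ### Geometric description -/

lemma barsOrthogonal_iff {i : ℕ} (hi : 1 ≤ i) : BarsOrthogonal q i ↔ tangencyEq i 0 q = 0 := by
  rw [tangencyEq_eq, reach_zero hi, real_inner_comm, BarsOrthogonal, bar_eq, bar_eq,
    Nat.sub_add_cancel hi]
  rfl

/-- The hyperplane passes through the first endpoint, so by convexity only the second endpoint
matters. -/
lemma segment_subset_hyperplane_iff (h i : ℕ) :
    segment ℝ (joint q (h + i)) (joint q (h + i + 1)) ⊆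
      (AffineSubspace.mk' (joint q (h + i)) (directionK h i q)ᗮ :
        Set (EuclideanSpace ℝ (Fin (m + 1)))) ↔ tangencyEq h i q = 0 := by
  have h1 : joint q (h + i + 1) ∈ AffineSubspace.mk' (joint q (h + i)) (directionK h i q)ᗮ ↔
      tangencyEq h i q = 0 := by
    rw [AffineSubspace.mem_mk', directionK, Submodule.mem_orthogonal_singleton_iff_inner_left]
    rfl
  rw [← h1]
  constructor
  · exact fun H => H (right_mem_segment ℝ _ _)
  · exact fun H => (AffineSubspace.convex _).segment_subset
      (AffineSubspace.self_mem_mk' _ _) H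

end Codes

end ArticulatedArm

theorem mainTheorem4 (m : ℕ) (hm : 2 ≤ m) :
    -- (1) tangency points lie over vertical points
    (∀ (k : ℕ) (q : Conf m k), q ∈ configSpace m k → IsTangency q k →
      ∃ l, IsGreatest {i | 2 ≤ i ∧ i ≤ k - 1 ∧ IsVertical q i} l ∧
        ∀ j, l < j → j ≤ k → IsTangency q j) ∧
    ∀ h l : ℕ, 1 ≤ h →
      -- (2) the class is an analytic submanifold of codimension `l + 1`, ...
      (IsAnalyticSubmanifold (configSpace m (h + l + 1))
          (rvtClass m (h + l + 1) (h + l + 1) (wordRVT h l)) (l + 1) ∧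
        -- ... cut out, in an open set, by the equations `φ_0 = ⋯ = φ_l = 0`, ...
        rvtClass m (h + l + 1) (h + l + 1) (wordRVT h l) =
          {q | q ∈ rvtClass m (h + l + 1) h (wordR h) ∧
            (∀ i, 1 ≤ i → i ≤ l → ¬ IsVertical q (h + i + 1)) ∧
            ∀ j ≤ l, tangencyEq h j q = 0} ∧
        (∃ U : Set (Conf m (h + l + 1)), IsOpen U ∧
          {q | q ∈ rvtClass m (h + l + 1) h (wordR h) ∧
            ∀ i, 1 ≤ i → i ≤ l → ¬ IsVertical q (h + i + 1)} = configSpace m (h + l + 1) ∩ U) ∧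
        -- ... which are independent on their set of common zeros;
        (∀ q ∈ configSpace m (h + l + 1), (∀ j ≤ l, tangencyEq h j q = 0) →
          LinearIndependent ℝ (fun j : Fin (l + 1) =>
            (fderiv ℝ (fun y : Conf m (h + l + 1) => tangencyEq h j y) q).toLinearMap.domRestrict
              (tangentSpace (configSpace m (h + l + 1)) q))) ∧
        -- the class projects onto the Cartan points of `C^h(m)`, with the following fibers
        under h '' rvtClass m (h + l + 1) (h + l + 1) (wordRVT h l) = cartanSet m h ∧
        (∀ p ∈ cartanSet m h,
          {q | q ∈ rvtClass m (h + l + 1) (h + l + 1) (wordRVT h l) ∧ under h q = p} =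
            {q | q ∈ (fiberTower h (under (h - 1) p) (l + 1)).carrier ∧ under h q = p ∧
              ∀ i, 1 ≤ i → i ≤ l → ¬ IsVertical q (h + i + 1)})) ∧
      -- (3) inductive description by means of the flag of `𝒟_{h+l+1}`
      ((rvtClass m (h + l + 1) h (wordR h) =
            {q | q ∈ configSpace m (h + l + 1) ∧ under h q ∈ cartanSet m h} ∧
          ∃ U : Set (Conf m (h + l + 1)), IsOpen U ∧
            rvtClass m (h + l + 1) h (wordR h) = configSpace m (h + l + 1) ∩ U) ∧
        rvtClass m (h + l + 1) (h + 1) (wordRVT h 0) =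
          {q | q ∈ rvtClass m (h + l + 1) h (wordR h) ∧
            flag (configSpace m (h + l + 1)) (armDist m (h + l + 1)) (h + l + 1) (h + 1) q ≤
              sandwichL (configSpace m (h + l + 1)) (armDist m (h + l + 1)) (h + l + 1)
                (h - 1) q} ∧
        ∀ i, 1 ≤ i → i ≤ l →
          rvtClass m (h + l + 1) (h + i + 1) (wordRVT h i) =
            {q | q ∈ rvtClass m (h + l + 1) (h + i) (wordRVT h (i - 1)) ∧
              flag (configSpace m (h + l + 1)) (armDist m (h + l + 1)) (h + l + 1)
                  (h + i + 1) q ≤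
                tangentSpace (rvtClass m (h + l + 1) (h + i) (wordRVT h (i - 1))) q ∧
              ¬ IsVertical q (h + i + 1)}) ∧
      -- (4) geometric description of the configurations
      ((∀ q ∈ rvtClass m (h + l + 1) (h + l + 1) (wordRVT h l), ∀ i ≤ l,
          joint q (h + i) ≠ joint q (h - 1)) ∧
        ∀ q ∈ configSpace m (h + l + 1),
          q ∈ rvtClass m (h + l + 1) (h + l + 1) (wordRVT h l) ↔
            (∀ i, 1 ≤ i → i ≤ h - 1 → ¬ BarsOrthogonal q i) ∧
            (∀ i ≤ l, segment ℝ (joint q (h + i)) (joint q (h + i + 1)) ⊆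
              (AffineSubspace.mk' (joint q (h + i)) (directionK h i q)ᗮ :
                Set (EuclideanSpace ℝ (Fin (m + 1))))) ∧
            (∀ i, 1 ≤ i → i ≤ l → ¬ BarsOrthogonal q (h + i))) := by
  refine ⟨fun k q hq ht => exists_isGreatest_isVertical hq ht, fun h l hh =>
    ⟨⟨isAnalyticSubmanifold_rvtClass hh le_rfl, rvtClass_wordRVT_eq hh le_rfl, ?_,
      fun q hq hφ => linearIndependent_fderiv_tangencyEq hh le_rfl hq hφ, ?_, ?_⟩,
    ⟨⟨?_, ?_⟩, ?_, ?_⟩, ?_, ?_⟩⟩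
  · refine ⟨transverse m (h + l + 1) ((Finset.Icc 1 (h + l)).erase h), isOpen_transverse _, ?_⟩
    ext q
    rw [Set.mem_ofPred_eq, mem_rvtClass_wordR (by omega), and_assoc, Set.mem_inter_iff]
    exact and_congr_right fun hq => (mem_transverse_split hh le_rfl hq).symm
  · ext p
    constructor
    · rintro ⟨q, hq, rfl⟩
      rw [rvtClass_wordRVT_eq hh le_rfl] at hq
      exact ((mem_rvtClass_wordR_iff_cartan hm (by omega)).1 hq.1).2
    · intro hp
      obtain ⟨q, hq, hqp⟩ := exists_rvtClass_over hm hh hp l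
      exact ⟨q, hq, hqp⟩
  · intro p hp
    ext q
    rw [Set.mem_ofPred_eq, rvtClass_wordRVT_eq hh le_rfl, Set.mem_ofPred_eq]
    change _ ↔ q ∈ (fiberTower h (under (h - 1) p) (l + 1)).carrier ∧ _
    rw [(fiberTower_eq hh _ (l + 1)).1]
    constructor
    · rintro ⟨⟨h1, h2, h3⟩, h4⟩
      refine ⟨⟨h1.1, ?_, fun s hs => h3 s (Nat.le_of_lt_succ hs)⟩, h4, h2⟩
      rw [← h4, under_under (Nat.sub_le _ _)]
    · rintro ⟨⟨h1, -, h3⟩, h4, h5⟩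
      refine ⟨⟨(mem_rvtClass_wordR_iff_cartan hm (by omega)).2 ⟨h1, h4.symm ▸ hp⟩, h5,
        fun j hj => h3 j (Nat.lt_succ_of_le hj)⟩, h4⟩
  · ext q
    exact mem_rvtClass_wordR_iff_cartan hm (by omega)
  · refine ⟨transverse m (h + l + 1) (Finset.Ico 1 h), isOpen_transverse _, ?_⟩
    ext q
    exact mem_rvtClass_wordR (by omega)
  · rw [rvtClass_wordRVT_eq (l := 0) hh (by omega)]
    ext q
    rw [Set.mem_ofPred_eq, Set.mem_ofPred_eq]
    refine and_congr_right fun hq => ?_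
    rw [flag_eq (by omega) q hq.1, sandwichL_eq hm (by omega) (by omega) hq.1,
      distModel_le_verticalModel_iff hh (by omega) hq.1]
    exact ⟨fun H => H.2 0 le_rfl, fun H => ⟨fun i h1 h2 => by omega, fun j hj => by
      obtain rfl : j = 0 := by omega
      exact H⟩⟩
  · intro i hi hil
    obtain ⟨i, rfl⟩ := Nat.exists_eq_add_of_le' hi
    rw [Nat.add_sub_cancel]
    ext q
    rw [Set.mem_ofPred_eq]
    -- Over the class with one tangency letter fewer, the flag condition is the single new equation
    -- φ_{i+1} = 0 (i is the former index minus one); together with non-verticality it appends one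
    -- letter T.
    have key : ∀ hq : q ∈ rvtClass m (h + l + 1) (h + (i + 1)) (wordRVT h i),
        (flag (configSpace m (h + l + 1)) (armDist m (h + l + 1)) (h + l + 1) (h + (i + 1) + 1) q ≤
          tangentSpace (rvtClass m (h + l + 1) (h + (i + 1)) (wordRVT h i)) q ↔
          tangencyEq h (i + 1) q = 0) := fun hq => by
      rw [flag_eq (by omega) q hq.1]
      exact distModel_le_tangentSpace_rvtClass hh (by omega) hq
    have e1 : q ∈ rvtClass m (h + l + 1) (h + (i + 1)) (wordRVT h i) ↔ _ :=
      Set.ext_iff.1 (rvtClass_wordRVT_eq (m := m) (k := h + l + 1) (l := i) hh (by omega)) q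
    rw [rvtClass_wordRVT_eq hh (by omega)]
    constructor
    · rintro ⟨h1, h2, h3⟩
      have h4 := e1.2 ⟨h1, fun s hs hsi => h2 s hs (by omega), fun j hj => h3 j (by omega)⟩
      exact ⟨h4, (key h4).2 (h3 _ le_rfl), h2 _ hi le_rfl⟩
    · rintro ⟨h4, h5, h6⟩
      obtain ⟨h1, h2, h3⟩ := e1.1 h4
      refine ⟨h1, fun s hs hsi => ?_, fun j hj => ?_⟩
      · rcases Nat.le_succ_iff.1 hsi with hsi | rfl
        · exact h2 s hs hsi
        · exact h6
      · rcases Nat.le_succ_iff.1 hj with hj | rfl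
        · exact h3 j hj
        · exact (key h4).1 h5
  · intro q hq i hi
    have h1 := (mem_rvtClass_wordRVT hh le_rfl).1 hq
    exact sub_ne_zero.1 (reach_ne_zero hh (by omega : h + l ≤ h + l + 1) h1.1
      (fun s hs => h1.2.2 s hs.le) hi)
  · intro q hq
    rw [mem_rvtClass_wordRVT hh le_rfl, mem_transverse_split hh le_rfl hq, and_assoc]
    simp only [segment_subset_hyperplane_iff]
    have e1 : q ∈ transverse m (h + l + 1) (Finset.Ico 1 h) ↔
        ∀ i, 1 ≤ i → i ≤ h - 1 → ¬ BarsOrthogonal q i := by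
      constructor
      · intro H i h1 h2
        rw [barsOrthogonal_iff h1]
        exact H i (Finset.mem_Ico.2 ⟨h1, by omega⟩)
      · intro H i hi
        rw [Finset.mem_Ico] at hi
        have := H i hi.1 (by omega)
        rwa [barsOrthogonal_iff hi.1] at this
    have e2 : (∀ i, 1 ≤ i → i ≤ l → ¬ IsVertical q (h + i + 1)) ↔
        ∀ i, 1 ≤ i → i ≤ l → ¬ BarsOrthogonal q (h + i) :=
      forall_congr' fun i => forall₂_congr fun h1 h2 => by
        rw [barsOrthogonal_iff (by omega), isVertical_succ_iff (by omega) (by omega) hq]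
    rw [e1, e2]
    tauto
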